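/- All graphs are finite, simple and undirected; $d_G(s,t)$ is the number of edges of a shortest $s$-$t$-path in $G$. For a subgraph $H$ of $G$, let $d_H(s,t)$ be the distance of $s$ and $t$ in $H$, with $d_H(s,t)=\infty$ if $s$ or $t$ is not a vertex of $H$ or if they are not connected in $H$. A $(c,\ell,k)$-tree-cover of $G=(V,E)$ is a collection $\mathcal C$ of subgraphs of $G$, each of which is a tree, such that for all $s,t\in V$ there is $T\in\mathcal C$ containing both $s$ and $t$ with $d_T(s,t)\le c\cdot d_G(s,t)$ or $d_T(s,t)\le d_G(s,t)+\ell$, and such that every vertex of $G$ lies in at most $k$ members of $\mathcal C$. Put $d_{\mathcal C}(s,t)=\min_{T\in\mathcal C}d_T(s,t)$. A port assignment of $G$ assigns to every vertex $s$ pairwise distinct numbers (ports) in $\{1,\dots,n\}$ to the neighbors of $s$, where $n=|V|$. **Theorem.** There are absolute constants and one fixed program for the unit-cost word RAM with word size $\Theta(\log n)$ (with addition, subtraction, multiplication, integer division and remainder, bitwise operations, shifts, comparisons and indirect addressing) such that the following holds. Let $G$ be a graph with $n$ vertices, let $\mathcal C$ be a $(c,\ell,k)$-tree-cover of $G$, and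 let any port assignment of $G$ be given. Then $d_{\mathcal C}$ is an integral semi-metric on $V$ (that is, $d_{\mathcal C}(s,t)\in\mathbb N$, $d_{\mathcal C}(s,t)=d_{\mathcal C}(t,s)$, and $d_{\mathcal C}(s,t)=0$ if and only if $s=t$), and one can store at each vertex a label such that for all vertices $s\ne t$ the program, given only the labels of $s$ and $t$, outputs the port at $s$ of a neighbor $v$ of $s$ to which $s$ forwards messages with target $t$, where: 1. (greedy) $d_{\mathcal C}(v,t)<d_{\mathcal C}(s,t)$; 2. (starvation-free) for all $s,t\in V$, a message sent from $s$ to $t$ and forwarded according to these decisions reaches $t$; 3. (stretch $c$ with additive bound $\ell$) for all $s,t\in V$, the number of edges traversed by the message until it reaches $t$ is at most $c\cdot d_G(s,t)$ or at most $d_G(s,t)+\ell$; 4. (space) the label of each vertex has $\mathcal O(k(\log^2 n+\log k))$ bits; 5. (time) each routing decision takes $\mathcal O(k)$ steps. -/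

import Mathlib

/-! ### Word RAM

Structured programs for a unit-cost word RAM with `w`-bit words. The machine has registers
(a program mentions only finitely many of them), a writable working memory, and two read-only
input arrays of words, called the source array and the target array. -/

namespace WordRAM

/-- The arithmetic and bitwise operations on words (all are taken on unsigned `w`-bit words, the
arithmetic modulo `2 ^ w`). -/
inductive BinOp : Type
  | add | sub | mul | div | mod | and | or | xor | shl | shr

/-- Value of an operation on two words. -/
def BinOp.eval {w : ℕ} : BinOp → BitVec w → BitVec w → BitVec w
  | .add, x, y => x + y
  | .sub, x, y => x - y
  | .mul, x, y => x * y
  | .div, x, y => x / y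
  | .mod, x, y => x % y
  | .and, x, y => x &&& y
  | .or, x, y => x ||| y
  | .xor, x, y => x ^^^ y
  | .shl, x, y => x <<< y
  | .shr, x, y => x >>> y

/-- Tests comparing the contents of two registers. -/
inductive Test : Type
  | lt (a b : ℕ)
  | eq (a b : ℕ)

/-- Programs. Natural-number arguments are register indices, except for the literal in `const`. -/
inductive Prog : Type
  /-- do nothing -/
  | skip
  /-- `r[dst] := literal` -/
  | const (dst literal : ℕ)
  /-- `r[dst] := r[a] o r[b]` -/
  | op (o : BinOp) (dst a b : ℕ)
  /-- `r[dst] := source[r[a]]` -/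
  | loadSource (dst a : ℕ)
  /-- `r[dst] := target[r[a]]` -/
  | loadTarget (dst a : ℕ)
  /-- `r[dst] := mem[r[a]]` -/
  | load (dst a : ℕ)
  /-- `mem[r[a]] := r[b]` -/
  | store (a b : ℕ)
  /-- sequential composition -/
  | seq (p q : Prog)
  /-- `if t then p else q` -/
  | cond (t : Test) (p q : Prog)
  /-- `while t do p` -/
  | loop (t : Test) (p : Prog)

/-- Contents of the registers and of the working memory. -/
structure State (w : ℕ) where
  reg : ℕ → BitVec w
  mem : BitVec w → BitVec w

/-- Initially all registers and memory cells hold `0`. -/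
def State.init (w : ℕ) : State w := ⟨fun _ => 0, fun _ => 0⟩

/-- Write `x` into register `dst`. -/
def State.setReg {w : ℕ} (σ : State w) (dst : ℕ) (x : BitVec w) : State w :=
  ⟨Function.update σ.reg dst x, σ.mem⟩

/-- Write `x` into the memory cell with address `i`. -/
def State.setMem {w : ℕ} (σ : State w) (i x : BitVec w) : State w :=
  ⟨σ.reg, Function.update σ.mem i x⟩

/-- Truth of a test in a state. -/
def Test.Holds {w : ℕ} : Test → State w → Prop
  | .lt a b, σ => (σ.reg a).toNat < (σ.reg b).toNat
  | .eq a b, σ => σ.reg a = σ.reg b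

/-- The word at address `i` of an input array (`0` beyond the end of the array). -/
def readArray {w : ℕ} (L : List (BitVec w)) (i : BitVec w) : BitVec w := L.getD i.toNat 0

/-- `Exec S T p σ τ σ'`: with source array `S` and target array `T`, program `p` started in state
`σ` terminates in state `σ'` after exactly `τ` steps. Every elementary instruction and every
evaluation of a test costs one step. -/
inductive Exec {w : ℕ} (S T : List (BitVec w)) : Prog → State w → ℕ → State w → Prop
  | skip (σ : State w) : Exec S T .skip σ 1 σ
  | const (dst c : ℕ) (σ : State w) :
      Exec S T (.const dst c) σ 1 (σ.setReg dst (BitVec.ofNat w c))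
  | op (o : BinOp) (dst a b : ℕ) (σ : State w) :
      Exec S T (.op o dst a b) σ 1 (σ.setReg dst (o.eval (σ.reg a) (σ.reg b)))
  | loadSource (dst a : ℕ) (σ : State w) :
      Exec S T (.loadSource dst a) σ 1 (σ.setReg dst (readArray S (σ.reg a)))
  | loadTarget (dst a : ℕ) (σ : State w) :
      Exec S T (.loadTarget dst a) σ 1 (σ.setReg dst (readArray T (σ.reg a)))
  | load (dst a : ℕ) (σ : State w) :
      Exec S T (.load dst a) σ 1 (σ.setReg dst (σ.mem (σ.reg a)))
  | store (a b : ℕ) (σ : State w) :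
      Exec S T (.store a b) σ 1 (σ.setMem (σ.reg a) (σ.reg b))
  | seq {p q : Prog} {σ σ₁ σ₂ : State w} {τ₁ τ₂ : ℕ} :
      Exec S T p σ τ₁ σ₁ → Exec S T q σ₁ τ₂ σ₂ → Exec S T (.seq p q) σ (τ₁ + τ₂) σ₂
  | condTrue {t : Test} {p q : Prog} {σ σ' : State w} {τ : ℕ} :
      t.Holds σ → Exec S T p σ τ σ' → Exec S T (.cond t p q) σ (τ + 1) σ'
  | condFalse {t : Test} {p q : Prog} {σ σ' : State w} {τ : ℕ} :
      ¬ t.Holds σ → Exec S T q σ τ σ' → Exec S T (.cond t p q) σ (τ + 1) σ'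
  | loopTrue {t : Test} {p : Prog} {σ σ₁ σ₂ : State w} {τ₁ τ₂ : ℕ} :
      t.Holds σ → Exec S T p σ τ₁ σ₁ → Exec S T (.loop t p) σ₁ τ₂ σ₂ →
      Exec S T (.loop t p) σ (τ₁ + τ₂ + 1) σ₂
  | loopFalse {t : Test} {p : Prog} {σ : State w} :
      ¬ t.Holds σ → Exec S T (.loop t p) σ 1 σ

/-- Executions are deterministic. -/
theorem Exec.deterministic {w : ℕ} {S T : List (BitVec w)} {p : Prog} {σ σ₁ σ₂ : State w}
    {τ₁ τ₂ : ℕ} (h₁ : Exec S T p σ τ₁ σ₁) (h₂ : Exec S T p σ τ₂ σ₂) : τ₁ = τ₂ ∧ σ₁ = σ₂ := by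
  induction h₁ generalizing τ₂ σ₂ with
  | seq _ _ ih₁ ih₂ =>
    cases h₂ with
    | seq g₁ g₂ =>
      obtain ⟨rfl, rfl⟩ := ih₁ g₁
      obtain ⟨rfl, rfl⟩ := ih₂ g₂
      exact ⟨rfl, rfl⟩
  | condTrue ht _ ih =>
    cases h₂ with
    | condTrue _ g => obtain ⟨rfl, rfl⟩ := ih g; exact ⟨rfl, rfl⟩
    | condFalse hf _ => exact absurd ht hf
  | condFalse hf _ ih =>
    cases h₂ with
    | condTrue ht _ => exact absurd ht hf
    | condFalse _ g => obtain ⟨rfl, rfl⟩ := ih g; exact ⟨rfl, rfl⟩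
  | loopTrue ht _ _ ih₁ ih₂ =>
    cases h₂ with
    | loopTrue _ g₁ g₂ =>
      obtain ⟨rfl, rfl⟩ := ih₁ g₁
      obtain ⟨rfl, rfl⟩ := ih₂ g₂
      exact ⟨rfl, rfl⟩
    | loopFalse hf => exact absurd ht hf
  | loopFalse hf =>
    cases h₂ with
    | loopTrue ht _ _ => exact absurd ht hf
    | loopFalse _ => exact ⟨rfl, rfl⟩
  | _ => cases h₂; exact ⟨rfl, rfl⟩

/-- On source array `S` and target array `T`, program `p` halts after exactly `τ` steps with
output `x`, the final content of register `0`. -/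
def Outputs {w : ℕ} (p : Prog) (S T : List (BitVec w)) (τ : ℕ) (x : BitVec w) : Prop :=
  ∃ σ : State w, Exec S T p (State.init w) τ σ ∧ σ.reg 0 = x

end WordRAM

/-! ### Covers -/

namespace Cover

variable {V : Type*} {G : SimpleGraph V}

/-- The distance between two vertices of `G` in a subgraph `H`; it is infinite if one of them does
not belong to `H` or if they lie in different components of `H`. -/
noncomputable def subgraphDist (H : G.Subgraph) (s t : V) : ℕ∞ :=
  ⨅ (hs : s ∈ H.verts) (ht : t ∈ H.verts), H.coe.edist ⟨s, hs⟩ ⟨t, ht⟩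

/-- The minimum of the distances between `s` and `t` in the members of a collection. -/
noncomputable def coverDist (C : Set G.Subgraph) (s t : V) : ℕ∞ :=
  ⨅ H ∈ C, subgraphDist H s t

/-- `C` is a `(c, ℓ, k)`-graph-cover of `G`. -/
structure IsGraphCover (C : Set G.Subgraph) (c ℓ : ℝ) (k : ℕ) : Prop where
  stretch : ∀ s t : V, ∃ H ∈ C, H.Connected ∧ ∃ m : ℕ, subgraphDist H s t = m ∧
    ((m : ℝ) ≤ c * G.dist s t ∨ (m : ℝ) ≤ G.dist s t + ℓ)
  multiplicity : ∀ v : V, {H ∈ C | v ∈ H.verts}.encard ≤ k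

/-- A `(c, ℓ, k)`-tree-cover is a `(c, ℓ, k)`-graph-cover all of whose members are trees. -/
structure IsTreeCover (C : Set G.Subgraph) (c ℓ : ℝ) (k : ℕ) : Prop
    extends IsGraphCover C c ℓ k where
  isTree : ∀ H ∈ C, H.coe.IsTree

end Cover

/-! ### Greedy routing -/

namespace Routing

variable {V : Type*}

/-- At every vertex `s`, the neighbors of `s` have pairwise distinct ports in `{1, …, n}`, where
`n` is the number of vertices. (Values at non-adjacent pairs are irrelevant.) -/
structure PortAssignment [Fintype V] (G : SimpleGraph V) where
  port : V → V → ℕ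
  mem_Icc : ∀ s v, G.Adj s v → port s v ∈ Finset.Icc 1 (Fintype.card V)
  injective : ∀ s u v, G.Adj s u → G.Adj s v → port s u = port s v → u = v

/-- Integral semi-metrics. -/
structure IsSemimetric (d : V → V → ℕ) : Prop where
  eq_zero_iff : ∀ s t, d s t = 0 ↔ s = t
  symm : ∀ s t, d s t = d t s

/-- Here `next s t` is the vertex to which a message for `t` is forwarded at `s`. The scheme is
greedy with respect to `d`: each message is forwarded to a neighbor that is closer to its
target. -/
def IsGreedy (G : SimpleGraph V) (d : V → V → ℕ) (next : V → V → V) : Prop :=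
  ∀ s t, s ≠ t → G.Adj s (next s t) ∧ d (next s t) t < d s t

/-- The message sent from `s` to `t` arrives at `t` for the first time after `m` hops. -/
def RouteLength (next : V → V → V) (s t : V) (m : ℕ) : Prop :=
  (fun v => next v t)^[m] s = t ∧ ∀ j < m, (fun v => next v t)^[j] s ≠ t

/-- Every message is delivered. -/
def IsStarvationFree (next : V → V → V) : Prop :=
  ∀ s t, ∃ m, RouteLength next s t m

/-- Multiplicative stretch `c` with additive bound `ℓ`. -/
def HasStretch (G : SimpleGraph V) (next : V → V → V) (c ℓ : ℝ) : Prop :=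
  ∀ s t m, RouteLength next s t m → (m : ℝ) ≤ c * G.dist s t ∨ (m : ℝ) ≤ G.dist s t + ℓ

/-- The program `p` makes the routing decisions of `next` in at most `τ` steps each: given only
the labels of `s` and of `t ≠ s`, it outputs the port at `s` of the vertex `next s t`. -/
def Implements [Fintype V] {G : SimpleGraph V} {w : ℕ} (p : WordRAM.Prog)
    (ports : PortAssignment G) (label : V → List (BitVec w)) (next : V → V → V) (τ : ℕ) : Prop :=
  ∀ s t, s ≠ t → ∃ τ' ≤ τ, ∃ x : BitVec w,
    WordRAM.Outputs p (label s) (label t) τ' x ∧ x.toNat = ports.port s (next s t)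

end Routing

universe u

/-! Greediness yields the semantic claims. Let `s` forward along a tree `T` of the cover that
minimizes the distance to `t`. The next vertex `v` satisfies `d_C(v,t) ≤ d_T(v,t) < d_T(s,t) =
d_C(s,t)`, so the message arrives after at most `d_C(s,t)` hops, and `d_C` inherits the stretch of
the cover. It remains to find such a port in `O(k)` steps from short labels.

For a single tree, a centroid divides the vertices into two parts of at most two thirds of the size,
and it lies between any two vertices of different parts. Recursion gives each vertex a code of
`O(log n)` bits, one per level (`IsTree.exists_code`). The lowest bit in which two codes differ is
the level at which `s` and `t` were separated; their distance is the sum of their distances to the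
separator `x` of that level. For each level a vertex stores its distance to `x`, its port towards
`x` and the port at `x` towards it. The first port is used if `s ≠ x`, and the second one, from the
label of `t`, if `s = x` (`exists_treeData`).

The level must be found in constant time without an instruction for the position of a bit. With `z`
the exclusive or of the codes, `z - (z &&& (z - 1))` is the power `2 ^ i` for the lowest set bit
`i`. Since 2 is a primitive root modulo `3 ^ (e + 1)`, the residues of `2 ^ i` are distinct for `i <
2 * 3 ^ e`, so they serve as perfect hash values into a table of size `O(log n)`
(`Nat.two_pow_mod_three_pow_injOn`).

One optimal tree per pair of vertices suffices, so at most `n ^ 2` trees are kept and their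
identifiers fit into a word (`exists_family`). Labels list the trees through a vertex by decreasing
identifier; merging two such lists meets all common trees (`loop_exec`). -/

namespace WordRAM

/-! ### The routing program: execution, running time and correctness -/

variable {w : ℕ}

/-- The part of a label that belongs to one tree; the functions give the entries by address. -/
structure Block (w : ℕ) where
  id : BitVec w
  code : BitVec w
  dist : BitVec w → BitVec w
  up : BitVec w → BitVec w
  down : BitVec w → BitVec w

/-- From address `a` on, the array `S` holds the blocks of a list, with tables of size `M` and
blocks of size `D`, followed by a `0`. -/
def Reads (S : List (BitVec w)) (M D : BitVec w) : BitVec w → List (Block w) → Prop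
  | a, [] => readArray S a = 0
  | a, b :: l => readArray S a = b.id ∧ readArray S (a + 1) = b.code ∧
      (∀ x, readArray S (a + 1 + 1 + x % M) = b.dist (x % M) ∧
        readArray S (a + 1 + 1 + x % M + M) = b.up (x % M) ∧
        readArray S (a + 1 + 1 + x % M + M + M) = b.down (x % M)) ∧ Reads S M D (a + D) l

/-- The identifier of the first block, `0` if there is none. -/
def headId : List (Block w) → BitVec w
  | [] => 0
  | b :: _ => b.id

theorem Reads.head {S : List (BitVec w)} {M D a : BitVec w} {l : List (Block w)}
    (h : Reads S M D a l) : readArray S a = headId l := by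
  cases l with
  | nil => exact h
  | cons b l => exact h.1

/-- The table address determined by two codes: their lowest different bit modulo `M`. -/
def slot (M x y : BitVec w) : BitVec w :=
  ((x ^^^ y) - ((x ^^^ y) &&& ((x ^^^ y) - 1))) % M

/-- The distance computed from two blocks. -/
def Block.sum (M : BitVec w) (b b' : Block w) : BitVec w :=
  b.dist (slot M b.code b'.code) + b'.dist (slot M b.code b'.code)

open Classical in
/-- The port computed from two blocks. -/
def Block.port (M : BitVec w) (b b' : Block w) : BitVec w :=
  if b.dist (slot M b.code b'.code) = 0 then b'.down (slot M b.code b'.code)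
  else b.up (slot M b.code b'.code)

/-- Compute the table address from the codes at the current positions. -/
def slotProg : Prog :=
  .seq (.op .add 11 5 2) <| .seq (.loadSource 12 11) <|
  .seq (.op .add 13 6 2) <| .seq (.loadTarget 14 13) <|
  .seq (.op .xor 15 12 14) <| .seq (.op .sub 16 15 2) <|
  .seq (.op .and 16 15 16) <| .seq (.op .sub 15 15 16) <| .op .mod 15 15 3

/-- Add the distances found at the table address. -/
def sumProg : Prog :=
  .seq (.op .add 11 11 2) <| .seq (.op .add 11 11 15) <| .seq (.loadSource 12 11) <|
  .seq (.op .add 13 13 2) <| .seq (.op .add 13 13 15) <| .seq (.loadTarget 14 13) <|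
  .op .add 16 12 14

/-- Load the port found at the table address. -/
def portProg : Prog :=
  .cond (.eq 12 1)
    (.seq (.op .add 13 13 3) <| .seq (.op .add 13 13 3) <| .loadTarget 0 13)
    (.seq (.op .add 11 11 3) <| .loadSource 0 11)

/-- Compare the current pair of blocks with the best pair so far. -/
def compareProg : Prog :=
  .seq slotProg <| .seq sumProg <|
  .cond (.lt 16 7) (.seq (.op .add 7 16 1) portProg) .skip

/-- Go to the next block of the source. -/
def nextSource : Prog := .seq (.op .add 5 5 4) (.loadSource 8 5)

/-- Go to the next block of the target. -/
def nextTarget : Prog := .seq (.op .add 6 6 4) (.loadTarget 9 6)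

/-- One step of merging the two lists of blocks. -/
def bodyProg : Prog :=
  .seq
    (.cond (.lt 9 8) nextSource <| .cond (.lt 8 9) nextTarget <|
      .seq compareProg <| .seq nextSource nextTarget)
    (.op .or 10 8 9)

/-- The preparations. -/
def initProg : Prog :=
  .seq (.const 2 1) <| .seq (.loadSource 3 1) <| .seq (.loadSource 4 2) <|
  .seq (.const 5 2) <| .seq (.const 6 2) <| .seq (.op .sub 7 1 2) <|
  .seq (.loadSource 8 5) <| .seq (.loadTarget 9 6) <| .op .or 10 8 9

/-- The routing program. -/
def routeProg : Prog := .seq initProg (.loop (.lt 1 10) bodyProg)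

/-- The registers describe the remaining lists of blocks. -/
structure Inv (S T : List (BitVec w)) (M D : BitVec w) (σ : State w) (l l' : List (Block w)) :
    Prop where
  zero : σ.reg 1 = 0
  one : σ.reg 2 = 1
  size : σ.reg 3 = M
  stride : σ.reg 4 = D
  source : Reads S M D (σ.reg 5) l
  target : Reads T M D (σ.reg 6) l'
  sourceId : σ.reg 8 = headId l
  targetId : σ.reg 9 = headId l'

variable {S T : List (BitVec w)} {M D : BitVec w}

theorem nextSource_exec {σ : State w} {b : Block w} {l l' : List (Block w)}
    (h : Inv S T M D σ (b :: l) l') :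
    ∃ σ', Exec S T nextSource σ 2 σ' ∧ Inv S T M D σ' l l' ∧
      σ'.reg 7 = σ.reg 7 ∧ σ'.reg 0 = σ.reg 0 := by
  have hl : Reads S M D (σ.reg 5 + D) l := h.source.2.2.2
  refine ⟨_, .seq (.op ..) (.loadSource ..), ⟨?_, ?_, ?_, ?_, ?_, ?_, ?_, ?_⟩, ?_, ?_⟩ <;>
    simp [State.setReg, BinOp.eval, h.zero, h.one, h.size, h.stride, h.targetId, h.target, hl,
      hl.head]

theorem nextTarget_exec {σ : State w} {b : Block w} {l l' : List (Block w)}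
    (h : Inv S T M D σ l (b :: l')) :
    ∃ σ', Exec S T nextTarget σ 2 σ' ∧ Inv S T M D σ' l l' ∧
      σ'.reg 7 = σ.reg 7 ∧ σ'.reg 0 = σ.reg 0 := by
  have hl : Reads T M D (σ.reg 6 + D) l' := h.target.2.2.2
  refine ⟨_, .seq (.op ..) (.loadTarget ..), ⟨?_, ?_, ?_, ?_, ?_, ?_, ?_, ?_⟩, ?_, ?_⟩ <;>
    simp [State.setReg, BinOp.eval, h.zero, h.one, h.size, h.stride, h.sourceId, h.source, hl,
      hl.head]

/-- Registers below `11` are unchanged. -/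
def Frame (σ σ' : State w) : Prop := ∀ r < 11, σ'.reg r = σ.reg r

theorem slotProg_exec {σ : State w} {b b' : Block w} {l l' : List (Block w)}
    (h : Inv S T M D σ (b :: l) (b' :: l')) :
    ∃ σ', Exec S T slotProg σ 9 σ' ∧ Frame σ σ' ∧ σ'.reg 11 = σ.reg 5 + 1 ∧
      σ'.reg 13 = σ.reg 6 + 1 ∧ σ'.reg 15 = slot M b.code b'.code := by
  have h₁ : readArray S (σ.reg 5 + 1) = b.code := h.source.2.1
  have h₂ : readArray T (σ.reg 6 + 1) = b'.code := h.target.2.1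
  refine ⟨_, .seq (.op ..) <| .seq (.loadSource ..) <| .seq (.op ..) <| .seq (.loadTarget ..) <|
    .seq (.op ..) <| .seq (.op ..) <| .seq (.op ..) <| .seq (.op ..) (.op ..), ?_, ?_, ?_, ?_⟩
  · intro r hr
    simp [State.setReg, show r ≠ 11 by omega, show r ≠ 12 by omega, show r ≠ 13 by omega,
      show r ≠ 14 by omega, show r ≠ 15 by omega, show r ≠ 16 by omega]
  all_goals simp [-BitVec.ofNat_eq_ofNat, State.setReg, BinOp.eval, h.one, h.size, h₁, h₂, slot]

theorem sumProg_exec {σ : State w} {b b' : Block w} {l l' : List (Block w)} {p q x : BitVec w}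
    (hp : Reads S M D p (b :: l)) (hq : Reads T M D q (b' :: l'))
    (h₂ : σ.reg 2 = 1) (h₁₁ : σ.reg 11 = p + 1) (h₁₃ : σ.reg 13 = q + 1)
    (h₁₅ : σ.reg 15 = x % M) :
    ∃ σ', Exec S T sumProg σ 7 σ' ∧ Frame σ σ' ∧ σ'.reg 11 = p + 1 + 1 + x % M ∧
      σ'.reg 13 = q + 1 + 1 + x % M ∧ σ'.reg 12 = b.dist (x % M) ∧
      σ'.reg 16 = b.dist (x % M) + b'.dist (x % M) := by
  have e₁ := (hp.2.2.1 x).1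
  have e₂ := (hq.2.2.1 x).1
  refine ⟨_, .seq (.op ..) <| .seq (.op ..) <| .seq (.loadSource ..) <| .seq (.op ..) <|
    .seq (.op ..) <| .seq (.loadTarget ..) (.op ..), ?_, ?_, ?_, ?_, ?_⟩
  · intro r hr
    simp [State.setReg, show r ≠ 11 by omega, show r ≠ 12 by omega, show r ≠ 13 by omega,
      show r ≠ 14 by omega, show r ≠ 16 by omega]
  all_goals simp [-BitVec.ofNat_eq_ofNat, State.setReg, BinOp.eval, h₂, h₁₁, h₁₃, h₁₅, e₁, e₂]

open Classical in
theorem portProg_exec {σ : State w} {b b' : Block w} {l l' : List (Block w)} {p q x : BitVec w}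
    (hp : Reads S M D p (b :: l)) (hq : Reads T M D q (b' :: l'))
    (h₁ : σ.reg 1 = 0) (h₃ : σ.reg 3 = M) (h₁₁ : σ.reg 11 = p + 1 + 1 + x % M)
    (h₁₃ : σ.reg 13 = q + 1 + 1 + x % M) (h₁₂ : σ.reg 12 = b.dist (x % M)) :
    ∃ τ ≤ 4, ∃ σ', Exec S T portProg σ τ σ' ∧ (∀ r < 11, r ≠ 0 → σ'.reg r = σ.reg r) ∧
      σ'.reg 0 = if b.dist (x % M) = 0 then b'.down (x % M) else b.up (x % M) := by
  have e₁ := (hp.2.2.1 x).2.1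
  have e₂ := (hq.2.2.1 x).2.2
  by_cases h : b.dist (x % M) = 0
  · refine ⟨_, ?_, _, .condTrue (by simpa [Test.Holds, h₁, h₁₂] using h)
      (.seq (.op ..) <| .seq (.op ..) (.loadTarget ..)), ?_, ?_⟩
    · norm_num
    · intro r hr h0
      simp [State.setReg, h0, show r ≠ 13 by omega]
    · simp [-BitVec.ofNat_eq_ofNat, State.setReg, BinOp.eval, h₃, h₁₃, e₂, h]
  · refine ⟨_, ?_, _, .condFalse (by simpa [Test.Holds, h₁, h₁₂] using h)
      (.seq (.op ..) (.loadSource ..)), ?_, ?_⟩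
    · norm_num
    · intro r hr h0
      simp [State.setReg, h0, show r ≠ 11 by omega]
    · simp [-BitVec.ofNat_eq_ofNat, State.setReg, BinOp.eval, h₃, h₁₁, e₁, h]

/-- Registers 0 and 7 hold the best port and the best distance so far; they and the registers from
10 on are free to change. -/
theorem Inv.congr {σ σ' : State w} {l l' : List (Block w)} (h : Inv S T M D σ l l')
    (hr : ∀ r < 10, r ≠ 0 → r ≠ 7 → σ'.reg r = σ.reg r) : Inv S T M D σ' l l' := by
  constructor
  · rw [hr 1] <;> first | exact h.zero | decide
  · rw [hr 2] <;> first | exact h.one | decide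
  · rw [hr 3] <;> first | exact h.size | decide
  · rw [hr 4] <;> first | exact h.stride | decide
  · rw [hr 5] <;> first | exact h.source | decide
  · rw [hr 6] <;> first | exact h.target | decide
  · rw [hr 8] <;> first | exact h.sourceId | decide
  · rw [hr 9] <;> first | exact h.targetId | decide

theorem compareProg_exec {σ : State w} {b b' : Block w} {l l' : List (Block w)}
    (h : Inv S T M D σ (b :: l) (b' :: l')) :
    ∃ τ ≤ 22, ∃ σ', Exec S T compareProg σ τ σ' ∧ Inv S T M D σ' (b :: l) (b' :: l') ∧
      (((b.sum M b').toNat < (σ.reg 7).toNat ∧ σ'.reg 7 = b.sum M b' ∧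
          σ'.reg 0 = b.port M b') ∨
        ((σ.reg 7).toNat ≤ (b.sum M b').toNat ∧ σ'.reg 7 = σ.reg 7 ∧ σ'.reg 0 = σ.reg 0)) := by
  obtain ⟨σ₁, e₁, f₁, g₁₁, g₁₃, g₁₅⟩ := slotProg_exec h
  obtain ⟨σ₂, e₂, f₂, k₁₁, k₁₃, k₁₂, k₁₆⟩ := sumProg_exec h.source h.target
    ((f₁ 2 (by decide)).trans h.one) g₁₁ g₁₃ g₁₅
  have f : Frame σ σ₂ := fun r hr => (f₂ r hr).trans (f₁ r hr)
  have h₂ : Inv S T M D σ₂ (b :: l) (b' :: l') := h.congr fun r hr _ _ => f r (by omega)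
  have k₇ : σ₂.reg 7 = σ.reg 7 := f 7 (by decide)
  by_cases hlt : (b.sum M b').toNat < (σ.reg 7).toNat
  · set σ₃ := σ₂.setReg 7 (BinOp.add.eval (σ₂.reg 16) (σ₂.reg 1)) with hσ₃
    have u : ∀ r, r ≠ 7 → σ₃.reg r = σ₂.reg r := fun r hr => by simp [hσ₃, State.setReg, hr]
    have u₇ : σ₃.reg 7 = b.sum M b' := by
      simp [hσ₃, State.setReg, BinOp.eval, h₂.zero, k₁₆]; rfl
    obtain ⟨τ, hτ, σ₄, e₄, f₄, p₄⟩ := portProg_exec (σ := σ₃) h.source h.target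
      ((u 1 (by decide)).trans h₂.zero) ((u 3 (by decide)).trans h₂.size)
      ((u 11 (by decide)).trans k₁₁) ((u 13 (by decide)).trans k₁₃) ((u 12 (by decide)).trans k₁₂)
    refine ⟨_, ?_, σ₄, .seq e₁ (.seq e₂ (.condTrue ?_ (.seq (.op ..) e₄))), ?_, .inl ⟨hlt, ?_, p₄⟩⟩
    · omega
    · simp only [Test.Holds, k₁₆, k₇]; exact hlt
    · exact h₂.congr fun r h₁ h₂ h₃ => (f₄ r (by omega) h₂).trans (u r h₃)
    · exact (f₄ 7 (by decide) (by decide)).trans u₇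
  · refine ⟨_, ?_, σ₂, .seq e₁ (.seq e₂ (.condFalse ?_ (.skip _))), h₂, .inr ⟨not_lt.1 hlt, k₇, ?_⟩⟩
    · norm_num
    · simp only [Test.Holds, k₁₆, k₇]; exact hlt
    · exact f 0 (by decide)

/-- The blocks have nonzero, strictly decreasing identifiers. -/
def Sorted (l : List (Block w)) : Prop :=
  (∀ b ∈ l, 0 < b.id.toNat) ∧ l.Pairwise fun b b' => b'.id.toNat < b.id.toNat

theorem Sorted.tail {b : Block w} {l : List (Block w)} (h : Sorted (b :: l)) : Sorted l :=
  ⟨fun c hc => h.1 c (List.mem_cons_of_mem _ hc), (List.pairwise_cons.1 h.2).2⟩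

theorem Sorted.le_headId {l : List (Block w)} (h : Sorted l) {b : Block w} (hb : b ∈ l) :
    b.id.toNat ≤ (headId l).toNat := by
  cases l with
  | nil => simp at hb
  | cons c l =>
    rcases List.mem_cons.1 hb with rfl | hb
    · exact le_rfl
    · exact ((List.pairwise_cons.1 h.2).1 b hb).le

theorem Sorted.lt_head {b c : Block w} {l : List (Block w)} (h : Sorted (b :: l)) (hc : c ∈ l) :
    c.id.toNat < b.id.toNat := (List.pairwise_cons.1 h.2).1 c hc

/-- The pair `(x, y)` is an optimal distance and a port for it, among the pairs of blocks of `l`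
and `l'` with the same identifier and the initial pair `(x₀, y₀)`. -/
def IsBest (M : BitVec w) (l l' : List (Block w)) (x₀ y₀ x y : BitVec w) : Prop :=
  ((x = x₀ ∧ y = y₀) ∨ ∃ b ∈ l, ∃ b' ∈ l', b.id = b'.id ∧ x = b.sum M b' ∧ y = b.port M b') ∧
  x.toNat ≤ x₀.toNat ∧ ∀ b ∈ l, ∀ b' ∈ l', b.id = b'.id → x.toNat ≤ (b.sum M b').toNat

/-- Identifiers decrease along both lists and an exhausted list reads as identifier 0. A head larger
than the other head therefore has no partner and can be dropped; equal heads are compared and both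
dropped. Each round shortens the remaining lists, at a cost of at most 40 steps. -/
theorem loop_exec (m : ℕ) : ∀ (l l' : List (Block w)) (σ : State w),
    l.length + l'.length = m → Sorted l → Sorted l' → Inv S T M D σ l l' →
    σ.reg 10 = σ.reg 8 ||| σ.reg 9 →
    ∃ τ ≤ 40 * m + 1, ∃ σ', Exec S T (.loop (.lt 1 10) bodyProg) σ τ σ' ∧
      IsBest M l l' (σ.reg 7) (σ.reg 0) (σ'.reg 7) (σ'.reg 0) := by
  induction m using Nat.strong_induction_on with
  | _ m ih =>
  intro l l' σ hm hl hl' h h₁₀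
  -- The end of a round, common to all three branches: refresh register 10, which is nonzero exactly
  -- while a block remains, and apply induction to the shorter lists.
  have step : ∀ (τ₁ : ℕ) (σ₁ : State w) (k k' : List (Block w)), τ₁ ≤ 30 →
      Exec S T (.cond (.lt 9 8) nextSource <| .cond (.lt 8 9) nextTarget <|
        .seq compareProg <| .seq nextSource nextTarget) σ τ₁ σ₁ →
      k.length + k'.length < m → Sorted k → Sorted k' → Inv S T M D σ₁ k k' →
      0 < (σ.reg 10).toNat →
      ∃ τ ≤ 40 * m + 1, ∃ σ', Exec S T (.loop (.lt 1 10) bodyProg) σ τ σ' ∧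
        IsBest M k k' (σ₁.reg 7) (σ₁.reg 0) (σ'.reg 7) (σ'.reg 0) := by
    intro τ₁ σ₁ k k' hτ₁ e₁ hk hs hs' hi hpos
    set σ₂ := σ₁.setReg 10 (BinOp.or.eval (σ₁.reg 8) (σ₁.reg 9)) with hσ₂
    have u : ∀ r, r ≠ 10 → σ₂.reg r = σ₁.reg r := fun r hr => by simp [hσ₂, State.setReg, hr]
    obtain ⟨τ₂, hτ₂, σ₃, e₃, b₃⟩ := ih _ hk k k' σ₂ rfl hs hs'
      (hi.congr fun r hr _ _ => u r (by omega)) (by simp [hσ₂, State.setReg, BinOp.eval])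
    rw [u 7 (by decide), u 0 (by decide)] at b₃
    refine ⟨_, ?_, σ₃, .loopTrue ?_ (.seq e₁ (.op ..)) e₃, b₃⟩
    · omega
    · simpa [Test.Holds, h.zero] using hpos
  have h₁₀' : 0 < (σ.reg 8).toNat ∨ 0 < (σ.reg 9).toNat → 0 < (σ.reg 10).toNat := by
    rw [h₁₀, BitVec.toNat_or]
    have := @Nat.left_le_or (σ.reg 8).toNat (σ.reg 9).toNat
    have := @Nat.right_le_or (σ.reg 8).toNat (σ.reg 9).toNat
    omega
  rcases lt_trichotomy (σ.reg 9).toNat (σ.reg 8).toNat with hlt | heq | hlt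
  · cases l with
    | nil => simp [h.sourceId, headId] at hlt
    | cons b l =>
    obtain ⟨σ₁, e₁, i₁, r₇, r₀⟩ := nextSource_exec h
    obtain ⟨τ, hτ, σ', e, best⟩ := step _ σ₁ l l' (by norm_num) (.condTrue hlt e₁)
      (by simp at hm; omega) hl.tail hl' i₁ (h₁₀' (by omega))
    rw [r₇, r₀] at best
    refine ⟨τ, hτ, σ', e, ?_, best.2.1, ?_⟩
    · exact best.1.imp_right fun ⟨c, hc, hh⟩ => ⟨c, List.mem_cons_of_mem _ hc, hh⟩
    · intro c hc c' hc' hid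
      -- The dropped head exceeds the largest identifier of `l'`, so it belongs to no matching pair.
      rcases List.mem_cons.1 hc with rfl | hc
      · have := hl'.le_headId hc'
        rw [← h.targetId] at this
        rw [h.sourceId] at hlt
        simp only [headId, hid] at hlt
        omega
      · exact best.2.2 c hc c' hc' hid
  · cases l with
    | nil =>
      cases l' with
      | nil =>
        refine ⟨1, by omega, σ, .loopFalse ?_, .inl ⟨rfl, rfl⟩, le_rfl, by simp⟩
        simp [Test.Holds, h₁₀, h.sourceId, h.targetId, headId]
      | cons b' l' =>
        have := hl'.1 b' (by simp)
        simp [h.sourceId, h.targetId, headId] at heq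
        simp [heq] at this
    | cons b l =>
      have hb := hl.1 b (by simp)
      cases l' with
      | nil =>
        simp [h.sourceId, h.targetId, headId] at heq
        simp [← heq] at hb
      | cons b' l' =>
        have hid : b.id = b'.id := by
          rw [h.sourceId, h.targetId] at heq
          exact BitVec.eq_of_toNat_eq heq.symm
        obtain ⟨τ₀, hτ₀, σ₀, e₀, i₀, alt⟩ := compareProg_exec h
        obtain ⟨σ₁, e₁, i₁, r₇, r₀⟩ := nextSource_exec i₀
        obtain ⟨σ₂, e₂, i₂, s₇, s₀⟩ := nextTarget_exec i₁
        obtain ⟨τ, hτ, σ', e, best⟩ := step _ σ₂ l l' (by omega)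
          (.condFalse (by simp [Test.Holds, heq]) (.condFalse (by simp [Test.Holds, heq])
            (.seq e₀ (.seq e₁ e₂))))
          (by simp at hm; omega) hl.tail hl'.tail i₂ (h₁₀' (by
            left; rw [h.sourceId]; exact hb))
        rw [s₇, s₀, r₇, r₀] at best
        -- By strict monotonicity the two equal heads match only each other.
        have key : ∀ c ∈ b :: l, ∀ c' ∈ b' :: l', c.id = c'.id →
            (c = b ∧ c' = b') ∨ (c ∈ l ∧ c' ∈ l') := by
          intro c hc c' hc' hcc
          rcases List.mem_cons.1 hc with rfl | hc <;> rcases List.mem_cons.1 hc' with rfl | hc'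
          · exact .inl ⟨rfl, rfl⟩
          · have := hl'.lt_head hc'
            rw [← hid, hcc] at this
            omega
          · have := hl.lt_head hc
            rw [hid, hcc] at this
            omega
          · exact .inr ⟨hc, hc'⟩
        have up : ∀ x y, (∃ c ∈ l, ∃ c' ∈ l', c.id = c'.id ∧ x = c.sum M c' ∧ y = c.port M c') →
            ∃ c ∈ b :: l, ∃ c' ∈ b' :: l', c.id = c'.id ∧ x = c.sum M c' ∧ y = c.port M c' :=
          fun x y ⟨c, hc, c', hc', hh⟩ =>
            ⟨c, List.mem_cons_of_mem _ hc, c', List.mem_cons_of_mem _ hc', hh⟩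
        refine ⟨τ, hτ, σ', e, ?_⟩
        rcases alt with ⟨a₁, a₂, a₃⟩ | ⟨a₁, a₂, a₃⟩
        · rw [a₂, a₃] at best
          refine ⟨.inr ?_, best.2.1.trans a₁.le, ?_⟩
          · rcases best.1 with ⟨q₁, q₂⟩ | q
            · exact ⟨b, by simp, b', by simp, hid, q₁, q₂⟩
            · exact up _ _ q
          · intro c hc c' hc' hcc
            rcases key c hc c' hc' hcc with ⟨rfl, rfl⟩ | ⟨hc, hc'⟩
            · exact best.2.1
            · exact best.2.2 c hc c' hc' hcc
        · rw [a₂, a₃] at best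
          refine ⟨best.1.imp_right (up _ _), best.2.1, ?_⟩
          intro c hc c' hc' hcc
          rcases key c hc c' hc' hcc with ⟨rfl, rfl⟩ | ⟨hc, hc'⟩
          · exact best.2.1.trans a₁
          · exact best.2.2 c hc c' hc' hcc
  · cases l' with
    | nil => simp [h.targetId, headId] at hlt
    | cons b' l' =>
    obtain ⟨σ₁, e₁, i₁, r₇, r₀⟩ := nextTarget_exec h
    obtain ⟨τ, hτ, σ', e, best⟩ := step _ σ₁ l l' (by norm_num)
      (.condFalse (by simp only [Test.Holds]; omega) (.condTrue hlt e₁))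
      (by simp at hm; omega) hl hl'.tail i₁ (h₁₀' (by omega))
    rw [r₇, r₀] at best
    refine ⟨τ, hτ, σ', e, ?_, best.2.1, ?_⟩
    · exact best.1.imp_right fun ⟨c, hc, c', hc', hh⟩ =>
        ⟨c, hc, c', List.mem_cons_of_mem _ hc', hh⟩
    · intro c hc c' hc' hid
      rcases List.mem_cons.1 hc' with rfl | hc'
      · have := hl.le_headId hc
        rw [← h.sourceId] at this
        rw [h.targetId] at hlt
        simp only [headId, ← hid] at hlt
        omega
      · exact best.2.2 c hc c' hc' hid

/-- The value `0 - 1` in register 7 is the largest word and plays the role of an infinite distance.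
-/
theorem initProg_exec {l l' : List (Block w)} (h₀ : readArray S 0 = M) (h₁ : readArray S 1 = D)
    (hS : Reads S M D 2 l) (hT : Reads T M D 2 l') :
    ∃ σ, Exec S T initProg (State.init w) 9 σ ∧ Inv S T M D σ l l' ∧
      σ.reg 10 = σ.reg 8 ||| σ.reg 9 ∧ σ.reg 7 = 0 - 1 := by
  have e : BitVec.ofNat w 2 = 2 := rfl
  have e' : BitVec.ofNat w 1 = 1 := rfl
  have e'' : BitVec.ofNat w 0 = 0 := rfl
  refine ⟨_, .seq (.const ..) <| .seq (.loadSource ..) <| .seq (.loadSource ..) <|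
    .seq (.const ..) <| .seq (.const ..) <| .seq (.op ..) <| .seq (.loadSource ..) <|
    .seq (.loadTarget ..) (.op ..), ⟨?_, ?_, ?_, ?_, ?_, ?_, ?_, ?_⟩, ?_, ?_⟩ <;>
  simp [State.setReg, State.init, BinOp.eval] <;> first | assumption | exact hS.head | exact hT.head

/-- The routing program outputs the port computed from an optimal pair of blocks. -/
theorem routeProg_outputs {l l' : List (Block w)} (h₀ : readArray S 0 = M)
    (h₁ : readArray S 1 = D) (hS : Reads S M D 2 l) (hT : Reads T M D 2 l') (hl : Sorted l)
    (hl' : Sorted l') (hex : ∃ b ∈ l, ∃ b' ∈ l', b.id = b'.id ∧ (b.sum M b').toNat < 2 ^ w - 1) :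
    ∃ τ ≤ 40 * (l.length + l'.length) + 10, ∃ b ∈ l, ∃ b' ∈ l', b.id = b'.id ∧
      Outputs routeProg S T τ (b.port M b') ∧
      ∀ c ∈ l, ∀ c' ∈ l', c.id = c'.id → (b.sum M b').toNat ≤ (c.sum M c').toNat := by
  obtain ⟨σ, e, i, r₁₀, r₇⟩ := initProg_exec h₀ h₁ hS hT
  obtain ⟨τ, hτ, σ', e', best⟩ := loop_exec _ l l' σ rfl hl hl' i r₁₀
  obtain ⟨c, hc, c', hc', hcc, hlt⟩ := hex
  have hle := best.2.2 c hc c' hc' hcc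
  rcases best.1 with ⟨h₇, -⟩ | ⟨b, hb, b', hb', hid, h₇, h₀⟩
  · exfalso
    rw [h₇, r₇] at hle
    have : (0 - 1 : BitVec w).toNat = 2 ^ w - 1 := by
      have h2 : 1 % 2 ^ w = 1 := Nat.mod_eq_of_lt (by omega)
      simp only [BitVec.toNat_sub, BitVec.ofNat_eq_ofNat, BitVec.toNat_ofNat, h2, Nat.zero_mod]
      rw [Nat.add_zero, Nat.mod_eq_of_lt (by omega)]
    omega
  · refine ⟨9 + τ, by omega, b, hb, b', hb', hid, ⟨σ', .seq e e', h₀⟩, ?_⟩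
    rw [← h₇]
    exact best.2.2

end WordRAM

/-! ### Balanced separation of trees -/

namespace SimpleGraph

variable {V : Type*} {G : SimpleGraph V}

/-- A neighbor of `z` closer to `u` is the second vertex of a shortest path from `z` to `u`, and
paths in a tree are unique. -/
theorem IsTree.eq_of_adj_of_dist_lt (hG : G.IsTree) {u z a b : V} (ha : G.Adj z a)
    (hb : G.Adj z b) (hda : G.dist u a < G.dist u z) (hdb : G.dist u b < G.dist u z) : a = b := by
  have key : ∀ a, G.Adj z a → G.dist u a < G.dist u z →
      ∃ p : G.Walk z u, p.IsPath ∧ p.snd = a := by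
    intro a ha hda
    obtain ⟨q, hq⟩ := hG.connected.exists_walk_length_eq_dist a u
    have := hG.dist_eq_dist_add_one_of_adj u ha
    refine ⟨.cons ha q, Walk.isPath_of_length_eq_dist _ ?_, by simp⟩
    rw [Walk.length_cons, hq, G.dist_comm, G.dist_comm (u := z)]
    omega
  obtain ⟨p, hp, rfl⟩ := key a ha hda
  obtain ⟨q, hq, rfl⟩ := key b hb hdb
  rw [(hG.existsUnique_path z u).unique hp hq]

theorem Connected.exists_adj_dist_lt (hG : G.Connected) {u x : V} (h : x ≠ u) :
    ∃ y, G.Adj x y ∧ G.dist u x = G.dist u y + 1 := by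
  obtain ⟨p, hp⟩ := hG.exists_walk_length_eq_dist x u
  cases p with
  | nil => exact absurd rfl h
  | @cons _ y _ hxy q =>
    refine ⟨_, hxy, ?_⟩
    have h₁ := G.dist_le q
    have h₂ : G.dist x u ≤ G.dist x y + G.dist y u := hG.dist_triangle
    rw [dist_eq_one_iff_adj.2 hxy] at h₂
    rw [Walk.length_cons] at hp
    rw [G.dist_comm, G.dist_comm (u := u)]
    omega

/-- In a tree, `x` separates `u` and `v` if the neighbor of `x` towards `v` leads away from
`u`. -/
theorem IsTree.dist_eq_add (hG : G.IsTree) {u v : V} (m : ℕ) : ∀ x y : V, G.dist v x = m →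
    G.Adj x y → G.dist v y < G.dist v x → G.dist u x < G.dist u y →
    G.dist u v = G.dist u x + G.dist x v := by
  induction m with
  | zero => intro x y h _ h' _; omega
  | succ m ih =>
    intro x y hm hxy hv hu
    have h₁ := hG.dist_eq_dist_add_one_of_adj u hxy
    have h₂ := hG.dist_eq_dist_add_one_of_adj v hxy
    by_cases hyv : y = v
    · subst hyv
      rw [dist_eq_one_iff_adj.2 hxy]
      omega
    obtain ⟨z, hyz, hz⟩ := hG.connected.exists_adj_dist_lt hyv
    have h₃ := hG.dist_eq_dist_add_one_of_adj u hyz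
    -- Otherwise `x` and `z` would both be neighbors of `y` closer to `u`, hence equal, although `z`
    -- is closer to `v` than `x` is.
    have hlt : G.dist u y < G.dist u z := by
      by_contra hcon
      have : x = z := hG.eq_of_adj_of_dist_lt hxy.symm hyz hu (by omega)
      subst this
      omega
    have := ih y z (by omega) hyz (by omega) hlt
    rw [this, G.dist_comm (u := y), G.dist_comm (u := x)]
    omega

variable [Fintype V]

open Classical in
/-- A centroid: every branch contains at most half of `S`. -/
theorem IsTree.exists_centroid (hG : G.IsTree) (S : Finset V) : ∃ x, ∀ y, G.Adj x y →
    2 * (S.filter fun u => G.dist u y < G.dist u x).card ≤ S.card := by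
  have := hG.connected.nonempty
  -- A minimizer of the sum of distances to `S`: moving from `x` to `y` gains one for each vertex of
  -- `S` in the branch of `y` and loses one for each other vertex of `S`.
  obtain ⟨x, hx⟩ := Finite.exists_min fun x => ∑ u ∈ S, G.dist u x
  refine ⟨x, fun y hxy => ?_⟩
  have h₁ : ∑ u ∈ S, G.dist u y + ∑ u ∈ S, (if G.dist u y < G.dist u x then 1 else 0) =
      ∑ u ∈ S, G.dist u x + ∑ u ∈ S, (if ¬ G.dist u y < G.dist u x then 1 else 0) := by
    rw [← Finset.sum_add_distrib, ← Finset.sum_add_distrib]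
    refine Finset.sum_congr rfl fun u _ => ?_
    have := hG.dist_eq_dist_add_one_of_adj u hxy
    split_ifs <;> omega
  rw [← Finset.card_filter, ← Finset.card_filter] at h₁
  have h₂ := S.card_filter_add_card_filter_not fun u => G.dist u y < G.dist u x
  have := hx y
  omega

end SimpleGraph

open Classical in
/-- If all fibers of a map are small, they can be put into two groups of balanced size. -/
theorem Finset.exists_balanced_fibers {α ι : Type*} (S : Finset α) (f : α → ι)
    (h : ∀ i, 2 * (S.filter fun u => f u = i).card ≤ S.card) :
    ∃ P : Finset ι, 3 * (S.filter fun u => f u ∈ P).card ≤ 2 * S.card ∧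
      3 * (S.filter fun u => f u ∉ P).card ≤ 2 * S.card := by
  -- The first group is a largest union of fibers with at most two thirds of the elements. Were the
  -- rest larger than two thirds, the group would have less than one third.
  obtain ⟨P, hP, hmax⟩ := ((S.image f).powerset.filter fun P =>
    3 * (S.filter fun u => f u ∈ P).card ≤ 2 * S.card).exists_max_image
      (fun P => (S.filter fun u => f u ∈ P).card) ⟨∅, by simp⟩
  simp only [mem_filter, mem_powerset] at hP hmax
  refine ⟨P, hP.2, ?_⟩
  by_contra hcon
  have hsum := S.card_filter_add_card_filter_not fun u => f u ∈ P
  have hne : (S.filter fun u => f u ∉ P).Nonempty := by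
    rw [← card_pos]; omega
  obtain ⟨u, hu⟩ := hne
  rw [mem_filter] at hu
  have hfib : 0 < (S.filter fun v => f v = f u).card := card_pos.2 ⟨u, by simp [hu.1]⟩
  have hi := h (f u)
  -- A single fiber is itself admissible, so by maximality it is no larger than the group. Adding an
  -- unused fiber to the group then stays below two thirds, a contradiction.
  have h₁ := hmax {f u}
  simp only [mem_singleton, singleton_subset_iff] at h₁
  have h₁ := h₁ ⟨mem_image_of_mem _ hu.1, by omega⟩
  have hun : (S.filter fun v => f v ∈ insert (f u) P).card =
      (S.filter fun v => f v = f u).card + (S.filter fun v => f v ∈ P).card := by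
    rw [← card_union_of_disjoint]
    · congr 1
      ext v
      simp only [mem_filter, mem_insert, mem_union]
      tauto
    · rw [disjoint_filter]
      intro v _ hv hvP
      exact hu.2 (hv ▸ hvP)
  have h₂ := hmax (insert (f u) P) ⟨insert_subset (mem_image_of_mem _ hu.1) hP.1, by omega⟩
  omega

namespace SimpleGraph

variable {V : Type*} {G : SimpleGraph V} [Fintype V]

-- The branches at a centroid `x` are the fibers to be grouped. Vertices on different sides lie in
-- different branches or one of them is `x`, so `x` is between them.
open Classical in
theorem IsTree.exists_balanced_split (hG : G.IsTree) {S : Finset V} (hS : 2 ≤ S.card) :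
    ∃ (x : V) (P : V → Prop), 3 * (S.filter fun u => P u).card ≤ 2 * S.card ∧
      3 * (S.filter fun u => ¬ P u).card ≤ 2 * S.card ∧
      ∀ u v, ¬ (P u ↔ P v) → G.dist u v = G.dist u x + G.dist x v := by
  obtain ⟨x, hx⟩ := hG.exists_centroid S
  have hf : ∀ u, ∃ y, (u = x ∧ y = x) ∨ (u ≠ x ∧ G.Adj x y ∧ G.dist u x = G.dist u y + 1) := by
    intro u
    by_cases hu : u = x
    · exact ⟨x, .inl ⟨hu, rfl⟩⟩
    · obtain ⟨y, hy⟩ := hG.connected.exists_adj_dist_lt (Ne.symm hu)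
      exact ⟨y, .inr ⟨hu, hy⟩⟩
  choose f hf using hf
  obtain ⟨P, h₁, h₂⟩ := S.exists_balanced_fibers f fun y => by
    by_cases hxy : G.Adj x y
    · refine le_trans (Nat.mul_le_mul_left 2 (Finset.card_le_card ?_)) (hx y hxy)
      intro u hu
      rw [Finset.mem_filter] at hu ⊢
      refine ⟨hu.1, ?_⟩
      rcases hf u with ⟨-, h⟩ | h
      · rw [hu.2] at h
        exact absurd h hxy.ne'
      · rw [hu.2] at h
        omega
    -- The only nonempty fiber over a non-neighbor is `{x}`; it is at most half of `S` because `S`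
    -- has at least two elements.
    · have : ∀ u ∈ S.filter fun u => f u = y, u = x := by
        intro u hu
        rw [Finset.mem_filter] at hu
        rcases hf u with h | h
        · exact h.1
        · exact absurd (hu.2 ▸ h.2.1) hxy
      refine le_trans (Nat.mul_le_mul_left 2 (Finset.card_le_one.2 fun u hu v hv => ?_)) hS
      rw [this u hu, this v hv]
  refine ⟨x, fun u => f u ∈ P, by convert h₁, by convert h₂, fun u v huv => ?_⟩
  have hne : f u ≠ f v := fun h => huv (by simp only [h])
  rcases hf v with h | h
  · simp [h.1]
  rcases hf u with h' | h'
  · simp [h'.1]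
  refine hG.dist_eq_add _ x (f v) rfl h.2.1 (by omega) ?_
  by_contra hcon
  have := hG.dist_eq_dist_add_one_of_adj u h.2.1
  exact hne (hG.eq_of_adj_of_dist_lt (u := u) h'.2.1 h.2.1 (by omega) (by omega))

open Classical in
/-- Recursive balanced splitting of a tree: every vertex `u` gets a bit string `code u` and a
sequence `center u` of vertices such that the lowest bit in which two codes differ gives the
position of a common separator. -/
theorem IsTree.exists_code (hG : G.IsTree) (L : ℕ) : ∀ S : Finset V, S.card * 2 ^ L ≤ 3 ^ L →
    ∃ (code : V → ℕ) (center : V → ℕ → V), (∀ u, code u < 2 ^ L) ∧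
      ∀ u ∈ S, ∀ v ∈ S, u ≠ v → ∃ i < L, (∀ j < i, (code u).testBit j = (code v).testBit j) ∧
        (code u).testBit i ≠ (code v).testBit i ∧ center u i = center v i ∧
        G.dist u v = G.dist u (center u i) + G.dist (center u i) v := by
  have := hG.connected.nonempty
  induction L with
  | zero =>
    intro S hS
    refine ⟨fun _ => 0, fun _ _ => Classical.arbitrary V, by simp, fun u hu v hv huv => ?_⟩
    exact absurd (Finset.card_le_one.1 (by simpa using hS) u hu v hv) huv
  | succ L ih =>
    intro S hS
    by_cases hS2 : S.card ≤ 1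
    · refine ⟨fun _ => 0, fun _ _ => Classical.arbitrary V, by simp, fun u hu v hv huv => ?_⟩
      exact absurd (Finset.card_le_one.1 hS2 u hu v hv) huv
    obtain ⟨x, P, h₁, h₂, hP⟩ := hG.exists_balanced_split (not_le.1 hS2)
    have small : ∀ m, 3 * m ≤ 2 * S.card → m * 2 ^ L ≤ 3 ^ L := by
      intro m hm
      have := Nat.mul_le_mul_right (2 ^ L) hm
      rw [pow_succ, pow_succ] at hS
      nlinarith
    obtain ⟨c₁, z₁, hc₁, hz₁⟩ := ih _ (small _ h₁)
    obtain ⟨c₂, z₂, hc₂, hz₂⟩ := ih _ (small _ h₂)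
    -- The side of the current split becomes bit 0, and the codes of the two recursive calls move up
    -- by one position.
    refine ⟨fun u => if P u then 2 * c₁ u + 1 else 2 * c₂ u,
      fun u i => if i = 0 then x else if P u then z₁ u (i - 1) else z₂ u (i - 1), ?_, ?_⟩
    · intro u
      have := hc₁ u
      have := hc₂ u
      rw [pow_succ]
      dsimp only
      split_ifs <;> omega
    · intro u hu v hv huv
      by_cases hPuv : P u ↔ P v
      · by_cases hPu : P u
        · have hPv := hPuv.1 hPu
          obtain ⟨i, hi, hj, hi', hz, hd⟩ := hz₁ u (by simp [*]) v (by simp [*]) huv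
          refine ⟨i + 1, by omega, ?_, ?_, ?_, ?_⟩
          · intro j hji
            cases j with
            | zero => simp [hPu, hPv]
            | succ j =>
              simpa [hPu, hPv, Nat.testBit_add_one, Nat.mul_add_div] using hj j (by omega)
          · simpa [hPu, hPv, Nat.testBit_add_one, Nat.mul_add_div] using hi'
          · simpa [hPu, hPv] using hz
          · simpa [hPu, hPv] using hd
        · have hPv : ¬ P v := fun h => hPu (hPuv.2 h)
          obtain ⟨i, hi, hj, hi', hz, hd⟩ := hz₂ u (by simp [*]) v (by simp [*]) huv
          refine ⟨i + 1, by omega, ?_, ?_, ?_, ?_⟩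
          · intro j hji
            cases j with
            | zero => simp [hPu, hPv]
            | succ j =>
              simpa [hPu, hPv, Nat.testBit_add_one] using hj j (by omega)
          · simpa [hPu, hPv, Nat.testBit_add_one] using hi'
          · simpa [hPu, hPv] using hz
          · simpa [hPu, hPv] using hd
      · refine ⟨0, by omega, by simp, ?_, by simp, by simpa using hP u v hPuv⟩
        by_cases hPu : P u <;> by_cases hPv : P v <;> simp_all

end SimpleGraph

/-! ### Arithmetic of the lowest differing bit -/

/-- Below bit `i` everything is zero, so subtracting 1 alters only the bits up to `i`, and the
conjunction clears exactly bit `i`. -/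
theorem Nat.sub_and_sub_one {z i : ℕ} (h : ∀ j < i, z.testBit j = false)
    (hi : z.testBit i = true) : z - (z &&& (z - 1)) = 2 ^ i := by
  obtain ⟨q, rfl⟩ : ∃ q, z = 2 ^ (i + 1) * q + 2 ^ i := by
    refine ⟨z / 2 ^ (i + 1), ?_⟩
    have : z % 2 ^ (i + 1) = 2 ^ i := by
      apply Nat.eq_of_testBit_eq
      intro j
      rw [Nat.testBit_mod_two_pow, Nat.testBit_two_pow]
      rcases lt_trichotomy j i with hj | rfl | hj
      · simp [h j hj, hj.ne']
      · simp [hi]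
      · simp [hj.ne, show ¬ j < i + 1 by omega]
    have := Nat.div_add_mod z (2 ^ (i + 1))
    omega
  have hpos : 0 < 2 ^ i := by positivity
  have hlt : 2 ^ i < 2 ^ (i + 1) := by rw [pow_succ]; omega
  have : (2 ^ (i + 1) * q + 2 ^ i) &&& (2 ^ (i + 1) * q + 2 ^ i - 1) = 2 ^ (i + 1) * q := by
    rw [Nat.add_sub_assoc hpos]
    apply Nat.eq_of_testBit_eq
    intro j
    rw [Nat.testBit_and, Nat.testBit_two_pow_mul_add _ hlt,
      Nat.testBit_two_pow_mul_add _ (by omega), Nat.testBit_two_pow_mul,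
      Nat.testBit_two_pow_sub_one, Nat.testBit_two_pow]
    by_cases hj : j < i + 1
    · rcases eq_or_ne i j with rfl | hij
      · simp
      · simp [hij, show j ≤ i by omega, show ¬ i < j by omega]
    · simp [hj, show i + 1 ≤ j by omega]
  omega

/-- For `d = j - i`, the modulus divides `2 ^ d - 1`. Reduction modulo 3 forces `d = 2 * m`, and
lifting the exponent gives `v₃(4 ^ m - 1) = 1 + v₃(m)`. Hence `3 ^ e` divides `m`, which is smaller
than `3 ^ e`. -/
theorem Nat.two_pow_mod_three_pow_injOn {e i j : ℕ} (hi : i < 2 * 3 ^ e) (hj : j < 2 * 3 ^ e)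
    (h : 2 ^ i % 3 ^ (e + 1) = 2 ^ j % 3 ^ (e + 1)) : i = j := by
  wlog hij : i ≤ j generalizing i j
  · exact (this hj hi h.symm (by omega)).symm
  obtain ⟨d, rfl⟩ := Nat.exists_eq_add_of_le hij
  have hd : 3 ^ (e + 1) ∣ 2 ^ d - 1 := by
    have h₁ : 3 ^ (e + 1) ∣ 2 ^ (i + d) - 2 ^ i := (Nat.modEq_iff_dvd' (Nat.pow_le_pow_right
      (by norm_num) hij)).1 h
    have h₂ : 2 ^ (i + d) - 2 ^ i = 2 ^ i * (2 ^ d - 1) := by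
      rw [Nat.mul_sub, pow_add, mul_one]
    rw [h₂] at h₁
    exact (Nat.Coprime.pow _ _ (by norm_num)).dvd_of_dvd_mul_left h₁
  have heven : 2 ∣ d := by
    have h3 : 3 ∣ 2 ^ d - 1 := (dvd_pow_self 3 (by omega)).trans hd
    by_contra hodd
    obtain ⟨m, rfl⟩ : ∃ m, d = 2 * m + 1 := ⟨d / 2, by omega⟩
    have : 2 ^ (2 * m + 1) % 3 = 2 := by
      rw [pow_succ, pow_mul, Nat.mul_mod, Nat.pow_mod]
      simp
    revert this h3
    have : 0 < 2 ^ (2 * m + 1) := by positivity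
    revert this
    generalize 2 ^ (2 * m + 1) = t
    intro _ _ _
    omega
  obtain ⟨m, rfl⟩ := heven
  rcases Nat.eq_zero_or_pos m with rfl | hm
  · rfl
  exfalso
  have hdvd : 3 ^ (e + 1) ∣ 4 ^ m - 1 ^ m := by
    rw [one_pow, show (4 : ℕ) = 2 ^ 2 by norm_num, ← pow_mul]
    exact hd
  have := Fact.mk Nat.prime_three
  have hval := padicValNat.pow_sub_pow (p := 3) (x := 4) (y := 1) (by decide) (by norm_num)
    (by norm_num) (by norm_num) hm.ne'
  have hne : 4 ^ m - 1 ^ m ≠ 0 := by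
    have : 1 < 4 ^ m := Nat.one_lt_pow hm.ne' (by norm_num)
    simp; omega
  rw [padicValNat_dvd_iff_le hne, hval, show 4 - 1 = 3 by norm_num, padicValNat_self] at hdvd
  have h3m : 3 ^ e ∣ m := (padicValNat_dvd_iff_le hm.ne').2 (by omega)
  have := Nat.le_of_dvd hm h3m
  omega

/-- Neither subtraction wraps around: the exclusive or is positive, and a conjunction is at most
each of its arguments. -/
theorem WordRAM.slot_toNat {w m x y i : ℕ} (hx : x < 2 ^ w) (hy : y < 2 ^ w) (hm : m < 2 ^ w)
    (h : ∀ j < i, x.testBit j = y.testBit j) (hi : x.testBit i ≠ y.testBit i) :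
    (slot (BitVec.ofNat w m) (BitVec.ofNat w x) (BitVec.ofNat w y)).toNat = 2 ^ i % m := by
  have hz : (x ^^^ y) - ((x ^^^ y) &&& ((x ^^^ y) - 1)) = 2 ^ i :=
    Nat.sub_and_sub_one (fun j hj => by simp [Nat.testBit_xor, h j hj])
      (by simpa [Nat.testBit_xor] using hi)
  have hne : x ^^^ y ≠ 0 := fun h0 => by
    rw [Nat.xor_eq_zero_iff] at h0
    exact hi (by rw [h0])
  have hlt : x ^^^ y < 2 ^ w := Nat.xor_lt_two_pow hx hy
  have h1 : 1 < 2 ^ w := by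
    rcases Nat.eq_zero_or_pos w with rfl | hw
    · rw [pow_zero] at hx hy
      exact absurd (by rw [show x = 0 by omega, show y = 0 by omega]; rfl) hne
    · exact Nat.one_lt_two_pow hw.ne'
  set Z : BitVec w := BitVec.ofNat w x ^^^ BitVec.ofNat w y with hZ
  have e₀ : Z.toNat = x ^^^ y := by
    simp [hZ, Nat.mod_eq_of_lt hx, Nat.mod_eq_of_lt hy]
  have o : (1 : BitVec w).toNat = 1 := by simp [Nat.mod_eq_of_lt h1]
  have e₁ : (Z - 1).toNat = (x ^^^ y) - 1 := by
    rw [BitVec.toNat_sub_of_le, e₀, o]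
    rw [BitVec.le_def, e₀, o]
    omega
  have e₂ : (Z &&& (Z - 1)).toNat = (x ^^^ y) &&& ((x ^^^ y) - 1) := by
    rw [BitVec.toNat_and, e₀, e₁]
  rw [slot, BitVec.toNat_umod, ← hZ, BitVec.toNat_sub_of_le, e₀, e₂, hz, BitVec.toNat_ofNat,
    Nat.mod_eq_of_lt hm]
  rw [BitVec.le_def, e₀, e₂]
  exact Nat.and_le_left

/-! ### Labels as arrays of words -/

namespace WordRAM

/-- The numbers stored for one tree; the table has three parts of equal size. -/
structure Entry where
  id : ℕ
  code : ℕ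
  table : ℕ → ℕ

/-- The block of words for an entry with table parts of size `m`. -/
def Entry.block (w m : ℕ) (e : Entry) : Block w where
  id := BitVec.ofNat w e.id
  code := BitVec.ofNat w e.code
  dist x := BitVec.ofNat w (e.table x.toNat)
  up x := BitVec.ofNat w (e.table (m + x.toNat))
  down x := BitVec.ofNat w (e.table (m + m + x.toNat))

/-- The list of numbers stored for an entry. -/
def Entry.flat (m : ℕ) (e : Entry) : List ℕ :=
  e.id :: e.code :: (List.range (3 * m)).map e.table

/-- The numbers of a label. -/
def flatLabel (m : ℕ) (l : List Entry) : List ℕ :=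
  m :: (2 + 3 * m) :: l.flatMap (Entry.flat m)

theorem Entry.length_flat (m : ℕ) (e : Entry) : (e.flat m).length = 2 + 3 * m := by
  simp [Entry.flat]; omega

theorem length_flatMap (m : ℕ) (l : List Entry) :
    (l.flatMap (Entry.flat m)).length = (2 + 3 * m) * l.length := by
  induction l with
  | nil => simp
  | cons e l ih => rw [List.flatMap_cons, List.length_append, ih, e.length_flat,
      List.length_cons]; ring

theorem length_flatLabel (m : ℕ) (l : List Entry) :
    (flatLabel m l).length = 2 + (2 + 3 * m) * l.length := by
  rw [flatLabel, List.length_cons, List.length_cons, length_flatMap]; ring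

theorem readArray_append {w : ℕ} {p q : List ℕ} {r : ℕ} (h : p.length + r < 2 ^ w) :
    readArray ((p ++ q).map (BitVec.ofNat w)) (BitVec.ofNat w (p.length + r)) =
      BitVec.ofNat w (q.getD r 0) := by
  rw [readArray, BitVec.toNat_ofNat, Nat.mod_eq_of_lt h, List.map_append,
    List.getD_append_right _ _ _ _ (by simp), List.length_map, Nat.add_sub_cancel_left,
    show (0 : BitVec w) = BitVec.ofNat w 0 from rfl, List.getD_map]

/-- No terminator is stored: reading past the end of the array yields the 0 that closes the list.
The length bound keeps all addresses from wrapping around. -/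
theorem reads_flatMap {w m : ℕ} (hm : 0 < m) (hmw : m < 2 ^ w) (l : List Entry) : ∀ p : List ℕ,
    p.length + (2 + 3 * m) * l.length < 2 ^ w →
    Reads ((p ++ l.flatMap (Entry.flat m)).map (BitVec.ofNat w)) (BitVec.ofNat w m)
      (BitVec.ofNat w (2 + 3 * m)) (BitVec.ofNat w p.length) (l.map (Entry.block w m)) := by
  induction l with
  | nil =>
    intro p hp
    have := readArray_append (w := w) (p := p) (q := []) (r := 0) (by simpa using hp)
    simpa [Reads] using this
  | cons e l ih =>
    intro p hp
    rw [List.length_cons, mul_add, mul_one] at hp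
    have read : ∀ r < 2 + 3 * m,
        readArray ((p ++ (e :: l).flatMap (Entry.flat m)).map (BitVec.ofNat w))
          (BitVec.ofNat w (p.length + r)) = BitVec.ofNat w ((e.flat m).getD r 0) := by
      intro r hr
      rw [readArray_append (by omega), List.flatMap_cons,
        List.getD_append _ _ _ _ (by rw [e.length_flat]; exact hr)]
    have tab : ∀ r < 3 * m, (e.flat m).getD (1 + 1 + r) 0 = e.table r := by
      intro r hr
      rw [show 1 + 1 + r = r + 1 + 1 by omega]
      simp [Entry.flat, hr]
    have one : (1 : BitVec w) = BitVec.ofNat w 1 := rfl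
    refine ⟨?_, ?_, fun x => ?_, ?_⟩
    · exact read 0 (by omega)
    · rw [one, ← BitVec.ofNat_add]
      exact read 1 (by omega)
    · have hx : (x % BitVec.ofNat w m).toNat < m := by
        rw [BitVec.toNat_umod, BitVec.toNat_ofNat, Nat.mod_eq_of_lt hmw]
        exact Nat.mod_lt _ hm
      generalize x % BitVec.ofNat w m = h at hx
      have hh : h = BitVec.ofNat w h.toNat := by simp
      have add : BitVec.ofNat w p.length + 1 + 1 + h =
          BitVec.ofNat w (p.length + (1 + 1 + h.toNat)) := by
        rw [one, ← BitVec.ofNat_add, ← BitVec.ofNat_add]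
        conv_lhs => rw [hh, ← BitVec.ofNat_add]
        congr 1
        omega
      refine ⟨?_, ?_, ?_⟩
      · rw [add, read _ (by omega), tab _ (by omega)]
        rfl
      · rw [add, ← BitVec.ofNat_add,
          show p.length + (1 + 1 + h.toNat) + m = p.length + (1 + 1 + (m + h.toNat)) by omega,
          read _ (by omega), tab _ (by omega)]
        rfl
      · rw [add, ← BitVec.ofNat_add, ← BitVec.ofNat_add,
          show p.length + (1 + 1 + h.toNat) + m + m =
            p.length + (1 + 1 + (m + m + h.toNat)) by omega,
          read _ (by omega), tab _ (by omega)]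
        rfl
    · have := ih (p ++ e.flat m) (by rw [List.length_append, e.length_flat]; omega)
      rwa [List.length_append, e.length_flat, BitVec.ofNat_add p.length, List.append_assoc,
        ← List.flatMap_cons] at this

theorem reads_flatLabel {w m : ℕ} (hm : 0 < m) {l : List Entry}
    (h : 2 + (2 + 3 * m) * l.length < 2 ^ w) (hmw : m < 2 ^ w) :
    readArray ((flatLabel m l).map (BitVec.ofNat w)) 0 = BitVec.ofNat w m ∧
    readArray ((flatLabel m l).map (BitVec.ofNat w)) 1 = BitVec.ofNat w (2 + 3 * m) ∧
    Reads ((flatLabel m l).map (BitVec.ofNat w)) (BitVec.ofNat w m)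
      (BitVec.ofNat w (2 + 3 * m)) 2 (l.map (Entry.block w m)) := by
  refine ⟨?_, ?_, reads_flatMap hm hmw l [m, 2 + 3 * m] h⟩
  · exact readArray_append (w := w) (p := []) (q := flatLabel m l) (r := 0) (by simp)
  · exact readArray_append (w := w) (p := []) (q := flatLabel m l) (r := 1)
      (by rw [List.length_nil]; omega)

end WordRAM

/-! ### Cover distances and the data for one tree -/

namespace Cover

variable {V : Type*} {G : SimpleGraph V}

theorem subgraphDist_eq_dist {H : G.Subgraph} (hH : H.coe.Connected) {s t : V} (hs : s ∈ H.verts)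
    (ht : t ∈ H.verts) : subgraphDist H s t = H.coe.dist ⟨s, hs⟩ ⟨t, ht⟩ := by
  simp [subgraphDist, hs, ht, (hH ⟨s, hs⟩ ⟨t, ht⟩).coe_dist_eq_edist]

theorem mem_of_subgraphDist_ne_top {H : G.Subgraph} {s t : V} (h : subgraphDist H s t ≠ ⊤) :
    s ∈ H.verts ∧ t ∈ H.verts := by
  by_contra hcon
  apply h
  simp only [subgraphDist, iInf_eq_top]
  intro hs ht
  exact absurd ⟨hs, ht⟩ hcon

theorem subgraphDist_comm (H : G.Subgraph) (s t : V) :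
    subgraphDist H s t = subgraphDist H t s := by
  simp only [subgraphDist]
  rw [iInf_comm]
  simp only [SimpleGraph.edist_comm]

theorem eq_of_subgraphDist_eq_zero {H : G.Subgraph} {s t : V} (h : subgraphDist H s t = 0) :
    s = t := by
  obtain ⟨hs, ht⟩ := mem_of_subgraphDist_ne_top (h ▸ ENat.zero_ne_top)
  simpa [subgraphDist, hs, ht] using h

theorem subgraphDist_self {H : G.Subgraph} {s : V} (hs : s ∈ H.verts) :
    subgraphDist H s s = 0 := by
  simp [subgraphDist, hs]

theorem coverDist_le {C : Set G.Subgraph} {H : G.Subgraph} (hH : H ∈ C) (s t : V) :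
    coverDist C s t ≤ subgraphDist H s t := iInf₂_le H hH

theorem exists_subgraphDist_eq_coverDist {C : Set G.Subgraph} (hC : C.Nonempty) (s t : V) :
    ∃ H ∈ C, subgraphDist H s t = coverDist C s t := by
  have := csInf_mem (hC.image fun H => subgraphDist H s t)
  rw [sInf_image] at this
  exact this

theorem IsGraphCover.coverDist_ne_top {C : Set G.Subgraph} {c ℓ : ℝ} {k : ℕ}
    (h : IsGraphCover C c ℓ k) (s t : V) : coverDist C s t ≠ ⊤ := by
  obtain ⟨H, hH, -, m, hm, -⟩ := h.stretch s t
  exact ne_top_of_le_ne_top (hm ▸ ENat.natCast_ne_top m) (coverDist_le hH s t)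

/-- The member with small stretch need not attain the minimum, but its distance bounds the minimum
from above. -/
theorem IsGraphCover.coverDist_stretch {C : Set G.Subgraph} {c ℓ : ℝ} {k : ℕ}
    (h : IsGraphCover C c ℓ k) {s t : V} {m : ℕ} (hm : m ≤ coverDist C s t) :
    (m : ℝ) ≤ c * G.dist s t ∨ (m : ℝ) ≤ G.dist s t + ℓ := by
  obtain ⟨H, hH, -, m', hm', h'⟩ := h.stretch s t
  have hle : (m : ℕ∞) ≤ m' := hm' ▸ hm.trans (coverDist_le hH s t)
  have hle : (m : ℝ) ≤ m' := by exact_mod_cast hle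
  exact h'.imp hle.trans hle.trans

theorem IsGraphCover.isSemimetric {C : Set G.Subgraph} {c ℓ : ℝ} {k : ℕ}
    (h : IsGraphCover C c ℓ k) :
    Routing.IsSemimetric fun s t => (coverDist C s t).toNat where
  eq_zero_iff s t := by
    rw [ENat.toNat_eq_zero, or_iff_left (h.coverDist_ne_top s t)]
    refine ⟨fun h0 => ?_, ?_⟩
    · obtain ⟨H₀, hH₀, -⟩ := h.stretch s t
      obtain ⟨H, -, hH⟩ := exists_subgraphDist_eq_coverDist ⟨H₀, hH₀⟩ s t
      exact eq_of_subgraphDist_eq_zero (hH.trans h0)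
    · rintro rfl
      obtain ⟨H, hH, -, m, hm, -⟩ := h.stretch s s
      have := mem_of_subgraphDist_ne_top (hm ▸ ENat.natCast_ne_top m)
      exact nonpos_iff_eq_zero.1 (subgraphDist_self this.1 ▸ coverDist_le hH s s)
  symm s t := by
    simp only [coverDist, subgraphDist_comm]

/-- At most `n ^ 2` members of a cover determine its distances. -/
theorem IsGraphCover.exists_family [Fintype V] {C : Set G.Subgraph} {c ℓ : ℝ} {k : ℕ}
    (h : IsGraphCover C c ℓ k) : ∃ N ≤ Fintype.card V ^ 2, ∃ T : Fin N → G.Subgraph,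
      Function.Injective T ∧ (∀ i, T i ∈ C) ∧
      ∀ s t, ∃ i, subgraphDist (T i) s t = coverDist C s t := by
  classical
  have hex : ∀ q : V × V, ∃ H ∈ C, subgraphDist H q.1 q.2 = coverDist C q.1 q.2 := by
    intro q
    obtain ⟨H₀, hH₀, -⟩ := h.stretch q.1 q.2
    exact exists_subgraphDist_eq_coverDist ⟨H₀, hH₀⟩ _ _
  choose f hfC hf using hex
  let F := Finset.univ.image f
  refine ⟨F.card, ?_, fun i => (F.equivFin.symm i : G.Subgraph), ?_, fun i => ?_, fun s t => ?_⟩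
  · exact Finset.card_image_le.trans (by simp [sq])
  · exact Subtype.val_injective.comp F.equivFin.symm.injective
  · obtain ⟨q, -, hq⟩ := Finset.mem_image.1 (F.equivFin.symm i).2
    simp only [← hq]
    exact hfC q
  · refine ⟨F.equivFin ⟨f (s, t), Finset.mem_image_of_mem _ (Finset.mem_univ _)⟩, ?_⟩
    simpa using hf (s, t)

/-- The data stored for a tree: a code for every vertex, and for every level the distance to the
separator, the port towards it, and the port at the separator towards the vertex. -/
theorem exists_treeData [Fintype V] {H : G.Subgraph} (hH : H.coe.IsTree)
    (ports : Routing.PortAssignment G) {L : ℕ} (hL : Fintype.card V * 2 ^ L ≤ 3 ^ L) :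
    ∃ (code : V → ℕ) (dist up down : V → ℕ → ℕ), (∀ v, code v < 2 ^ L) ∧
      ∀ s ∈ H.verts, ∀ t ∈ H.verts, s ≠ t → ∃ i < L,
        (∀ j < i, (code s).testBit j = (code t).testBit j) ∧
        (code s).testBit i ≠ (code t).testBit i ∧
        subgraphDist H s t = (dist s i + dist t i : ℕ) ∧ dist s i + dist t i < Fintype.card V ∧
        ∃ v, G.Adj s v ∧ subgraphDist H v t < subgraphDist H s t ∧
          (if dist s i = 0 then down t i else up s i) = ports.port s v := by
  classical
  have hcard : Fintype.card H.verts ≤ Fintype.card V :=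
    Fintype.card_le_of_injective _ Subtype.val_injective
  obtain ⟨code, center, hcode, hsep⟩ := hH.exists_code L Finset.univ
    ((Nat.mul_le_mul_right _ hcard).trans hL)
  have hnb : ∀ u x : H.verts, ∃ y, u ≠ x → H.coe.Adj u y ∧
      H.coe.dist x u = H.coe.dist x y + 1 := by
    intro u x
    by_cases h : u = x
    · exact ⟨u, fun h' => absurd h h'⟩
    · obtain ⟨y, hy⟩ := hH.connected.exists_adj_dist_lt h
      exact ⟨y, fun _ => hy⟩
  choose nb hnb using hnb
  refine ⟨fun v => if h : v ∈ H.verts then code ⟨v, h⟩ else 0,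
    fun v i => if h : v ∈ H.verts then H.coe.dist ⟨v, h⟩ (center ⟨v, h⟩ i) else 0,
    fun v i => if h : v ∈ H.verts then
      ports.port v (nb ⟨v, h⟩ (center ⟨v, h⟩ i)) else 0,
    fun v i => if h : v ∈ H.verts then
      ports.port (center ⟨v, h⟩ i) (nb (center ⟨v, h⟩ i) ⟨v, h⟩) else 0, ?_, ?_⟩
  · intro v
    dsimp only
    split_ifs
    · exact hcode _
    · positivity
  intro s hs t ht hst
  simp only [hs, ht, dif_pos]
  have hst' : (⟨s, hs⟩ : H.verts) ≠ ⟨t, ht⟩ := fun h => hst (congrArg Subtype.val h)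
  obtain ⟨i, hi, hj, hne, hcen, hd⟩ := hsep ⟨s, hs⟩ (Finset.mem_univ _) ⟨t, ht⟩
    (Finset.mem_univ _) hst'
  have hd' := hd
  rw [H.coe.dist_comm (u := center _ i), hcen] at hd'
  refine ⟨i, hi, hj, hne, ?_, ?_, ?_⟩
  · rw [subgraphDist_eq_dist hH.connected hs ht, hd']
    rw [hcen]
  · rw [hcen, ← hd']
    obtain ⟨p, hp, hlen⟩ := hH.connected.exists_path_of_dist ⟨s, hs⟩ ⟨t, ht⟩
    rw [← hlen]
    exact hp.length_lt.trans_le hcard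
  -- If `s` is the separator, the port towards `t` comes from the data of `t`. Otherwise a step
  -- towards the separator is a step towards `t`, by the triangle inequality.
  · by_cases h0 : (⟨s, hs⟩ : H.verts) = center ⟨s, hs⟩ i
    · have hn := hnb _ _ hst'
      refine ⟨nb ⟨s, hs⟩ ⟨t, ht⟩, hn.1.adj_sub, ?_, ?_⟩
      · rw [subgraphDist_eq_dist hH.connected (nb ⟨s, hs⟩ ⟨t, ht⟩).2 ht,
          subgraphDist_eq_dist hH.connected hs ht, H.coe.dist_comm, H.coe.dist_comm (u := ⟨s, hs⟩),
          hn.2]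
        exact_mod_cast Nat.lt_succ_self _
      · rw [← h0] at hcen ⊢
        rw [if_pos H.coe.dist_self, ← hcen]
    · have hn := hnb _ _ h0
      refine ⟨nb ⟨s, hs⟩ (center ⟨s, hs⟩ i), hn.1.adj_sub, ?_, ?_⟩
      · have htri := hH.connected.dist_triangle (u := nb ⟨s, hs⟩ (center ⟨s, hs⟩ i))
          (v := center ⟨s, hs⟩ i) (w := ⟨t, ht⟩)
        have hn2 := hn.2
        rw [H.coe.dist_comm, H.coe.dist_comm (u := center _ i)] at hn2
        rw [subgraphDist_eq_dist hH.connected (nb ⟨s, hs⟩ _).2 ht,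
          subgraphDist_eq_dist hH.connected hs ht]
        norm_cast
        simp only [Subtype.coe_eta]
        omega
      · rw [if_neg]
        rwa [hH.connected.dist_eq_zero_iff]

end Cover

/-! ### Tables indexed by residues, and assembly of the labels -/

namespace WordRAM

open Classical in
/-- The exponent `i < L` with `2 ^ i % m = h`. -/
noncomputable def level (L m h : ℕ) : ℕ :=
  if H : ∃ i < L, 2 ^ i % m = h then H.choose else 0

theorem level_two_pow {L e i : ℕ} (hL : L ≤ 2 * 3 ^ e) (hi : i < L) :
    level L (3 ^ (e + 1)) (2 ^ i % 3 ^ (e + 1)) = i := by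
  have H : ∃ j < L, 2 ^ j % 3 ^ (e + 1) = 2 ^ i % 3 ^ (e + 1) := ⟨i, hi, rfl⟩
  rw [level, dif_pos H]
  exact Nat.two_pow_mod_three_pow_injOn (H.choose_spec.1.trans_le hL) (hi.trans_le hL)
    H.choose_spec.2

/-- The entry with the given values at the levels below `L`. -/
noncomputable def levelEntry (L m id code : ℕ) (dist up down : ℕ → ℕ) : Entry where
  id := id
  code := code
  table r := if r < m then dist (level L m r) else
    if r < m + m then up (level L m (r - m)) else down (level L m (r - (m + m)))

theorem levelEntry_block {w L e i : ℕ} (hL : L ≤ 2 * 3 ^ e) (hi : i < L) {x : BitVec w}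
    (hx : x.toNat = 2 ^ i % 3 ^ (e + 1)) (id code : ℕ) (dist up down : ℕ → ℕ) :
    ((levelEntry L (3 ^ (e + 1)) id code dist up down).block w (3 ^ (e + 1))).dist x =
      BitVec.ofNat w (dist i) ∧
    ((levelEntry L (3 ^ (e + 1)) id code dist up down).block w (3 ^ (e + 1))).up x =
      BitVec.ofNat w (up i) ∧
    ((levelEntry L (3 ^ (e + 1)) id code dist up down).block w (3 ^ (e + 1))).down x =
      BitVec.ofNat w (down i) := by
  have hlt : 2 ^ i % 3 ^ (e + 1) < 3 ^ (e + 1) := Nat.mod_lt _ (by positivity)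
  have hlev := level_two_pow hL hi
  simp only [Entry.block, levelEntry, hx]
  refine ⟨?_, ?_, ?_⟩
  · rw [if_pos hlt, hlev]
  · rw [if_neg (by omega), if_pos (by omega), Nat.add_sub_cancel_left, hlev]
  · rw [if_neg (by omega), if_neg (by omega), Nat.add_sub_cancel_left, hlev]

end WordRAM

namespace Cover

open WordRAM

variable {V : Type*} {G : SimpleGraph V}

open Classical in
/-- The indices of the members of a family that contain a vertex, in decreasing order. -/
noncomputable def indicesAt {N : ℕ} (T : Fin N → G.Subgraph) (v : V) : List (Fin N) :=
  (List.finRange N).reverse.filter fun i => v ∈ (T i).verts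

theorem mem_indicesAt {N : ℕ} {T : Fin N → G.Subgraph} {v : V} {i : Fin N} :
    i ∈ indicesAt T v ↔ v ∈ (T i).verts := by
  simp [indicesAt]

theorem pairwise_indicesAt {N : ℕ} (T : Fin N → G.Subgraph) (v : V) :
    (indicesAt T v).Pairwise fun i j => j < i := by
  refine List.Pairwise.filter _ ?_
  rw [List.pairwise_reverse]
  exact List.pairwise_lt_finRange N

theorem length_indicesAt_le {N : ℕ} (T : Fin N → G.Subgraph) (v : V) :
    (indicesAt T v).length ≤ N := by
  refine (List.length_filter_le _ _).trans ?_
  simp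

theorem IsGraphCover.length_indicesAt_le {C : Set G.Subgraph} {c ℓ : ℝ} {k N : ℕ}
    (h : IsGraphCover C c ℓ k) {T : Fin N → G.Subgraph} (hinj : Function.Injective T)
    (hC : ∀ i, T i ∈ C) (v : V) : (indicesAt T v).length ≤ k := by
  classical
  have hnd : ((indicesAt T v).map T).Nodup :=
    List.Nodup.map hinj ((pairwise_indicesAt T v).imp fun h => h.ne')
  have hle : ((((indicesAt T v).map T).toFinset : Set G.Subgraph)).encard ≤ k := by
    refine (Set.encard_le_encard ?_).trans (h.multiplicity v)
    intro H hH
    simp only [List.coe_toFinset, List.mem_map, Set.mem_ofPred_eq] at hH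
    obtain ⟨i, hi, rfl⟩ := hH
    exact ⟨hC i, mem_indicesAt.1 hi⟩
  rw [Set.encard_coe_eq_coe_finsetCard, List.toFinset_card_of_nodup hnd, List.length_map] at hle
  exact_mod_cast hle

/-- Labels for a family of trees, with which the routing program outputs a port towards the target
in a tree of the family with minimum distance. -/
theorem exists_labels [Fintype V] {N w L e : ℕ} (T : Fin N → G.Subgraph) (hT : ∀ i, (T i).coe.IsTree)
    (ports : Routing.PortAssignment G) (hL : Fintype.card V * 2 ^ L ≤ 3 ^ L)
    (hLe : L ≤ 2 * 3 ^ e) (hLw : L ≤ w) (hn : Fintype.card V < 2 ^ w)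
    (hN : 2 + (2 + 3 * 3 ^ (e + 1)) * N < 2 ^ w) (hm : 3 ^ (e + 1) < 2 ^ w) :
    ∃ label : V → List (BitVec w),
      (∀ v, (label v).length = 2 + (2 + 3 * 3 ^ (e + 1)) * (indicesAt T v).length) ∧
      ∀ s t, s ≠ t → (∃ i, s ∈ (T i).verts ∧ t ∈ (T i).verts) →
        ∃ i, (∀ j, subgraphDist (T i) s t ≤ subgraphDist (T j) s t) ∧
          ∃ v, G.Adj s v ∧ subgraphDist (T i) v t < subgraphDist (T i) s t ∧
            ∃ τ ≤ 40 * ((indicesAt T s).length + (indicesAt T t).length) + 10,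
              ∃ x, Outputs routeProg (label s) (label t) τ x ∧ x.toNat = ports.port s v := by
  have hdata := fun i => exists_treeData (hT i) ports hL
  choose code dist up down hcode hdata using hdata
  -- Identifiers are shifted by one because 0 marks the end of a list.
  let entry : V → Fin N → Entry := fun v i =>
    levelEntry L (3 ^ (e + 1)) (i + 1) (code i v) (dist i v) (up i v) (down i v)
  let blk : V → Fin N → Block w := fun v i => (entry v i).block w (3 ^ (e + 1))
  have hNw : N + 1 < 2 ^ w := by
    have := Nat.le_mul_of_pos_left N (show 0 < 2 + 3 * 3 ^ (e + 1) by positivity)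
    omega
  have hid : ∀ v i, (blk v i).id.toNat = i + 1 := fun v i => by
    have := i.2
    change (BitVec.ofNat w (i + 1)).toNat = i + 1
    rw [BitVec.toNat_ofNat, Nat.mod_eq_of_lt (by omega)]
  have hsorted : ∀ v, Sorted ((indicesAt T v).map (blk v)) := fun v => by
    refine ⟨fun b hb => ?_, ?_⟩
    · obtain ⟨i, -, rfl⟩ := List.mem_map.1 hb
      rw [hid]
      omega
    · rw [List.pairwise_map]
      refine (pairwise_indicesAt T v).imp fun {i j} hij => ?_
      rw [hid, hid]
      exact Nat.succ_lt_succ hij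
  have hread := fun v => reads_flatLabel (w := w) (m := 3 ^ (e + 1))
    (l := (indicesAt T v).map (entry v)) (by positivity) (by
      rw [List.length_map]
      have := Nat.mul_le_mul_left (2 + 3 * 3 ^ (e + 1)) (length_indicesAt_le T v)
      omega) hm
  have hbm : ∀ v, ((indicesAt T v).map (entry v)).map (Entry.block w (3 ^ (e + 1))) =
      (indicesAt T v).map (blk v) := fun v => by
    rw [List.map_map]; rfl
  refine ⟨fun v => (flatLabel (3 ^ (e + 1)) ((indicesAt T v).map (entry v))).map (BitVec.ofNat w),
    fun v => ?_, ?_⟩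
  · rw [List.length_map, length_flatLabel, List.length_map]
  intro s t hst ⟨i₀, hs₀, ht₀⟩
  have hpair : ∀ i, s ∈ (T i).verts → t ∈ (T i).verts →
      subgraphDist (T i) s t =
        (((blk s i).sum (BitVec.ofNat w (3 ^ (e + 1))) (blk t i)).toNat : ℕ) ∧
      ((blk s i).sum (BitVec.ofNat w (3 ^ (e + 1))) (blk t i)).toNat < Fintype.card V ∧
      ∃ v, G.Adj s v ∧ subgraphDist (T i) v t < subgraphDist (T i) s t ∧
        ((blk s i).port (BitVec.ofNat w (3 ^ (e + 1))) (blk t i)).toNat = ports.port s v := by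
    intro i hs ht
    obtain ⟨j, hj, hlow, hne, hd, hlt, v, hv, hvd, hport⟩ := hdata i s hs t ht hst
    have hw : 2 ^ L ≤ 2 ^ w := Nat.pow_le_pow_right (by norm_num) hLw
    have hslot := slot_toNat ((hcode i s).trans_le hw) ((hcode i t).trans_le hw) hm hlow hne
    have hbs := levelEntry_block hLe hj hslot (i + 1) (code i s) (dist i s) (up i s) (down i s)
    have hbt := levelEntry_block hLe hj hslot (i + 1) (code i t) (dist i t) (up i t) (down i t)
    have hsum : ((blk s i).sum (BitVec.ofNat w (3 ^ (e + 1))) (blk t i)).toNat =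
        dist i s j + dist i t j := by
      refine (congrArg BitVec.toNat (congrArg₂ (· + ·) hbs.1 hbt.1)).trans ?_
      rw [← BitVec.ofNat_add, BitVec.toNat_ofNat, Nat.mod_eq_of_lt (by omega)]
    have hz : BitVec.ofNat w (dist i s j) = 0 ↔ dist i s j = 0 := by
      rw [← BitVec.toNat_inj, BitVec.toNat_ofNat, Nat.mod_eq_of_lt (by omega)]
      simp
    refine ⟨by rw [hsum, hd], by rw [hsum]; exact hlt, v, hv, hvd, ?_⟩
    have hportw : ports.port s v < 2 ^ w :=
      (Finset.mem_Icc.1 (ports.mem_Icc s v hv)).2.trans_lt hn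
    have : (blk s i).port (BitVec.ofNat w (3 ^ (e + 1))) (blk t i) =
        BitVec.ofNat w (ports.port s v) := by
      rw [← hport]
      refine (if_congr (Eq.congr_left hbs.1) hbt.2.2 hbs.2.1).trans ?_
      by_cases h0 : dist i s j = 0
      · rw [if_pos (hz.2 h0), if_pos h0]
      · rw [if_neg (fun h => h0 (hz.1 h)), if_neg h0]
    rw [this, BitVec.toNat_ofNat, Nat.mod_eq_of_lt hportw]
  have hsame : ∀ i j, (blk s i).id = (blk t j).id → i = j := fun i j h => by
    have := congrArg BitVec.toNat h
    rw [hid, hid] at this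
    exact Fin.ext (by omega)
  have hs := hread s
  have ht := hread t
  rw [hbm] at hs ht
  obtain ⟨τ, hτ, b, hb, b', hb', hbb, hout, hmin⟩ := routeProg_outputs hs.1 hs.2.1 hs.2.2 ht.2.2
    (hsorted s) (hsorted t) ⟨blk s i₀, List.mem_map_of_mem (mem_indicesAt.2 hs₀), blk t i₀,
      List.mem_map_of_mem (mem_indicesAt.2 ht₀), rfl, by
        have := (hpair i₀ hs₀ ht₀).2.1
        omega⟩
  obtain ⟨i, hi, rfl⟩ := List.mem_map.1 hb
  obtain ⟨j, hj, rfl⟩ := List.mem_map.1 hb'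
  obtain rfl := hsame i j hbb
  rw [mem_indicesAt] at hi hj
  obtain ⟨hd, -, v, hv, hvd, hport⟩ := hpair i hi hj
  refine ⟨i, fun j' => ?_, v, hv, hvd, τ, by simpa using hτ, _, hout, hport⟩
  by_cases htop : subgraphDist (T j') s t = ⊤
  · rw [htop]; exact le_top
  obtain ⟨hs', ht'⟩ := mem_of_subgraphDist_ne_top htop
  rw [hd, (hpair j' hs' ht').1]
  exact_mod_cast hmin _ (List.mem_map_of_mem (mem_indicesAt.2 hs')) _
    (List.mem_map_of_mem (mem_indicesAt.2 ht')) rfl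

end Cover

/-! ### Consequences of greediness -/

namespace Routing

variable {V : Type*} {G : SimpleGraph V} {d : V → V → ℕ} {next : V → V → V}

/-- In a greedy scheme, a message is delivered after at most `d s t` hops. -/
theorem IsGreedy.exists_routeLength (h : IsGreedy G d next) (m : ℕ) :
    ∀ s t, d s t ≤ m → ∃ r ≤ d s t, RouteLength next s t r := by
  induction m with
  | zero =>
    intro s t hm
    refine ⟨0, Nat.zero_le _, ?_, by simp⟩
    by_contra hst
    have := (h s t hst).2
    omega
  | succ m ih =>
    intro s t hm
    by_cases hst : s = t
    · exact ⟨0, Nat.zero_le _, hst, by simp⟩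
    have hlt := (h s t hst).2
    obtain ⟨r, hr, h₁, h₂⟩ := ih (next s t) t (by omega)
    refine ⟨r + 1, by omega, h₁, fun j hj => ?_⟩
    cases j with
    | zero => exact hst
    | succ j => exact h₂ j (by omega)

theorem RouteLength.unique {s t : V} {m m' : ℕ} (h : RouteLength next s t m)
    (h' : RouteLength next s t m') : m = m' := by
  rcases lt_trichotomy m m' with hlt | heq | hlt
  · exact absurd h.1 (h'.2 m hlt)
  · exact heq
  · exact absurd h'.1 (h.2 m' hlt)

theorem IsGreedy.isStarvationFree (h : IsGreedy G d next) : IsStarvationFree next := fun s t =>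
  (h.exists_routeLength _ s t le_rfl).imp fun _ hr => hr.2

theorem IsGreedy.routeLength_le (h : IsGreedy G d next) {s t : V} {m : ℕ}
    (hm : RouteLength next s t m) : m ≤ d s t := by
  obtain ⟨r, hr, hr'⟩ := h.exists_routeLength _ s t le_rfl
  rwa [hm.unique hr']

end Routing

/-! ### Choice of parameters and conclusion -/

/-- Parameters of the labels: the number of levels, the table size and the word size fit. -/
theorem exists_label_parameters {n N : ℕ} (hN : N ≤ n ^ 2) (hn : 2 ≤ n) :
    ∃ e, n * 2 ^ (2 * Nat.size n) ≤ 3 ^ (2 * Nat.size n) ∧ 2 * Nat.size n ≤ 2 * 3 ^ e ∧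
      2 + (2 + 3 * 3 ^ (e + 1)) * N < 2 ^ (10 * Nat.size n) ∧ 3 ^ (e + 1) < 2 ^ (10 * Nat.size n) ∧
      3 ^ (e + 1) ≤ 9 * Nat.size n := by
  set s := Nat.size n with hs
  have hns : n < 2 ^ s := Nat.lt_size_self n
  have hs2 : 1 < s := Nat.lt_size.2 (by simpa using hn)
  have hss : s < 2 ^ s := Nat.lt_two_pow_self
  have he : 3 ^ Nat.clog 3 s ≤ 3 * s := by
    have h1 := Nat.pow_pred_clog_lt_self (b := 3) (by norm_num) hs2
    have h2 := Nat.clog_pos (b := 3) (by norm_num) hs2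
    obtain ⟨m, hm⟩ : ∃ m, Nat.clog 3 s = m + 1 := ⟨_, (Nat.succ_pred_eq_of_pos h2).symm⟩
    rw [hm] at h1 ⊢
    rw [pow_succ]
    simp only [Nat.pred_succ] at h1
    omega
  have h4 : 4 ≤ 2 ^ s := by
    calc 4 = 2 ^ 2 := by norm_num
      _ ≤ 2 ^ s := Nat.pow_le_pow_right (by norm_num) hs2
  have hpow : 2 ^ (10 * s) = (2 ^ s) ^ 10 := by rw [← pow_mul, mul_comm]
  -- With `2 * s` levels, `n * 4 ^ s ≤ 8 ^ s ≤ 9 ^ s`. The exponent is the least with `s ≤ 3 ^ e`,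
  -- which makes the hashing injective on the levels and keeps the table linear in `s`.
  refine ⟨Nat.clog 3 s, ?_, ?_, ?_, ?_, ?_⟩
  · calc n * 2 ^ (2 * s) ≤ 2 ^ s * 2 ^ (2 * s) := Nat.mul_le_mul_right _ hns.le
      _ = 8 ^ s := by rw [← pow_add, show s + 2 * s = 3 * s by ring, pow_mul]; norm_num
      _ ≤ 9 ^ s := Nat.pow_le_pow_left (by norm_num) _
      _ = 3 ^ (2 * s) := by rw [pow_mul]; norm_num
  · exact Nat.mul_le_mul_left _ (Nat.le_pow_clog (by norm_num) s)
  · rw [hpow, pow_succ]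
    generalize 2 ^ s = q at *
    have hNq : N ≤ q ^ 2 := hN.trans (Nat.pow_le_pow_left hns.le _)
    calc 2 + (2 + 3 * (3 ^ Nat.clog 3 s * 3)) * N ≤ 2 + (2 + 27 * q) * q ^ 2 :=
          Nat.add_le_add_left (Nat.mul_le_mul (by omega) hNq) _
      _ < q ^ 10 := by
          have h6 : 4 ^ 6 ≤ q ^ 6 := Nat.pow_le_pow_left h4 6
          have h3 : 64 ≤ q ^ 3 := Nat.pow_le_pow_left h4 3
          calc 2 + (2 + 27 * q) * q ^ 2 ≤ 2 + (q + 27 * q) * q ^ 2 := by gcongr; omega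
            _ = 2 + 28 * q ^ 3 := by ring
            _ < 4 ^ 6 * q ^ 3 := by omega
            _ ≤ q ^ 6 * q ^ 3 := Nat.mul_le_mul_right _ h6
            _ = q ^ 9 := by ring
            _ ≤ q ^ 10 := Nat.pow_le_pow_right (by omega) (by norm_num)
  · rw [hpow, pow_succ]
    generalize 2 ^ s = q at *
    calc 3 ^ Nat.clog 3 s * 3 ≤ 9 * q := by omega
      _ < 4 ^ 9 * q := by omega
      _ ≤ q ^ 9 * q := Nat.mul_le_mul_right _ (Nat.pow_le_pow_left h4 9)
      _ = q ^ 10 := by ring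
  · rw [pow_succ]
    omega

theorem size_le_two_mul_logb {n : ℕ} (hn : 2 ≤ n) : (Nat.size n : ℝ) ≤ 2 * Real.logb 2 n := by
  have hs : 1 < Nat.size n := Nat.lt_size.2 (by simpa using hn)
  have h1 : 2 ^ (Nat.size n - 1) ≤ n := Nat.lt_size.1 (by omega)
  have h2 : ((Nat.size n - 1 : ℕ) : ℝ) ≤ Real.logb 2 n := by
    rw [Real.le_logb_iff_rpow_le (by norm_num) (by positivity), Real.rpow_natCast]
    exact_mod_cast h1
  have h3 : (Nat.size n : ℝ) ≤ 2 * ((Nat.size n - 1 : ℕ) : ℝ) := by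
    exact_mod_cast (by omega : Nat.size n ≤ 2 * (Nat.size n - 1))
  linarith

theorem mainTheorem2 :
    ∃ (p : WordRAM.Prog) (a A B : ℕ),
      ∀ (V : Type u) [Fintype V] (G : SimpleGraph V) (c ℓ : ℝ) (k : ℕ) (C : Set G.Subgraph),
        Cover.IsTreeCover C c ℓ k →
        ∀ ports : Routing.PortAssignment G,
          ∃ (label : V → List (BitVec (a * Nat.size (Fintype.card V))))
            (next : V → V → V) (d : V → V → ℕ),
            (∀ s t, (d s t : ℕ∞) = Cover.coverDist C s t) ∧
            Routing.IsSemimetric d ∧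
            Routing.IsGreedy G d next ∧
            Routing.IsStarvationFree next ∧
            Routing.HasStretch G next c ℓ ∧
            (∀ v, (((a * Nat.size (Fintype.card V)) * (label v).length : ℕ) : ℝ) ≤
              A * (k * (Real.logb 2 (Fintype.card V) ^ 2 + Real.logb 2 k))) ∧
            Routing.Implements p ports label next (B * k) := by
  classical
  -- With `s = Nat.size n`, a label has at most `10 * s * (2 + 29) * k * s = 310 * k * s ^ 2` bits,
  -- and `s ≤ 2 * log₂ n` gives `1240 = 4 * 310`; the term `log k` is not needed. The time is `40 *
  -- (2 * k) + 10 ≤ 90 * k`, as `k ≥ 1`.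
  refine ⟨WordRAM.routeProg, 10, 1240, 90, fun V _ G c ℓ k C hC ports => ?_⟩
  have hcov := hC.toIsGraphCover
  set d : V → V → ℕ := fun s t => (Cover.coverDist C s t).toNat with hd
  have hd' : ∀ s t, (d s t : ℕ∞) = Cover.coverDist C s t := fun s t =>
    ENat.natCast_toNat (hcov.coverDist_ne_top s t)
  suffices ∃ label : V → List (BitVec (10 * Nat.size (Fintype.card V))),
      (∀ v, (((10 * Nat.size (Fintype.card V)) * (label v).length : ℕ) : ℝ) ≤
        (1240 : ℕ) * (k * (Real.logb 2 (Fintype.card V) ^ 2 + Real.logb 2 k))) ∧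
      ∀ s t, s ≠ t → ∃ v, G.Adj s v ∧ d v t < d s t ∧ ∃ τ ≤ 90 * k, ∃ x,
        WordRAM.Outputs WordRAM.routeProg (label s) (label t) τ x ∧
        x.toNat = ports.port s v by
    obtain ⟨label, hlabel, hroute⟩ := this
    have hroute' : ∀ s t, ∃ v, s ≠ t → G.Adj s v ∧ d v t < d s t ∧ ∃ τ ≤ 90 * k, ∃ x,
        WordRAM.Outputs WordRAM.routeProg (label s) (label t) τ x ∧
        x.toNat = ports.port s v := fun s t => by
      by_cases hst : s = t
      · exact ⟨s, fun h => absurd hst h⟩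
      · exact (hroute s t hst).imp fun v hv _ => hv
    choose next hnext using hroute'
    have hgreedy : Routing.IsGreedy G d next := fun s t hst =>
      ⟨(hnext s t hst).1, (hnext s t hst).2.1⟩
    refine ⟨label, next, d, hd', hcov.isSemimetric, hgreedy, hgreedy.isStarvationFree, ?_, hlabel,
      fun s t hst => (hnext s t hst).2.2⟩
    intro s t m hm
    apply hcov.coverDist_stretch
    rw [← hd']
    exact_mod_cast hgreedy.routeLength_le hm
  have hlogk : 0 ≤ Real.logb 2 k := by
    rcases Nat.eq_zero_or_pos k with rfl | hk
    · simp
    · exact Real.logb_nonneg (by norm_num) (by exact_mod_cast hk)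
  -- With at most one vertex `log₂ n` vanishes, so the labels are chosen empty; there is nothing to
  -- route.
  by_cases hn : Fintype.card V ≤ 1
  · refine ⟨fun _ => [], fun v => ?_, fun s t hst => ?_⟩
    · rw [List.length_nil, mul_zero, Nat.cast_zero]
      positivity
    · exact absurd (Fintype.card_le_one_iff.1 hn s t) hst
  rw [not_le] at hn
  obtain ⟨N, hN, T, hinj, hTC, hT⟩ := hcov.exists_family
  obtain ⟨e, hL, hLe, hNw, hm, hms⟩ := exists_label_parameters hN hn
  have hnw : Fintype.card V < 2 ^ (10 * Nat.size (Fintype.card V)) :=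
    (Nat.lt_size_self _).trans_le (Nat.pow_le_pow_right (by norm_num) (by omega))
  obtain ⟨label, hlen, hlabel⟩ := Cover.exists_labels T (fun i => hC.isTree _ (hTC i)) ports hL hLe
    (by omega) hnw hNw hm
  have hk : ∀ v, (Cover.indicesAt T v).length ≤ k := hcov.length_indicesAt_le hinj hTC
  have hk1 : ∀ _ : V, 1 ≤ k := fun v => by
    obtain ⟨i, hi⟩ := hT v v
    have hv := (Cover.mem_of_subgraphDist_ne_top (hi ▸ hcov.coverDist_ne_top v v)).1
    exact (List.length_pos_of_mem (Cover.mem_indicesAt.2 hv)).trans_le (hk v)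
  refine ⟨label, fun v => ?_, fun s t hst => ?_⟩
  · have hs1 : 1 ≤ Nat.size (Fintype.card V) := Nat.size_pos.2 (by omega)
    have hbits : (10 * Nat.size (Fintype.card V)) * (label v).length ≤
        310 * (k * Nat.size (Fintype.card V) ^ 2) := by
      rw [hlen]
      calc _ ≤ (10 * Nat.size (Fintype.card V)) *
            (2 * (k * Nat.size (Fintype.card V)) + (2 * Nat.size (Fintype.card V) +
              3 * (9 * Nat.size (Fintype.card V))) * k) := by
            gcongr
            · exact Nat.le_mul_of_pos_right 2 (Nat.mul_pos (hk1 v) hs1)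
            · omega
            · exact hk v
        _ = _ := by ring
    have hsize := size_le_two_mul_logb hn
    calc (((10 * Nat.size (Fintype.card V)) * (label v).length : ℕ) : ℝ) ≤
          (310 * (k * Nat.size (Fintype.card V) ^ 2) : ℕ) := by exact_mod_cast hbits
      _ = 310 * (k * (Nat.size (Fintype.card V) : ℝ) ^ 2) := by push_cast; ring
      _ ≤ 310 * (k * (2 * Real.logb 2 (Fintype.card V)) ^ 2) := by gcongr
      _ = (1240 : ℕ) * (k * (Real.logb 2 (Fintype.card V) ^ 2 + 0)) := by push_cast; ring
      _ ≤ _ := by gcongr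
  · obtain ⟨i₀, hi₀⟩ := hT s t
    obtain ⟨i, hmin, v, hv, hvd, τ, hτ, x, hx⟩ := hlabel s t hst
      ⟨i₀, Cover.mem_of_subgraphDist_ne_top (hi₀ ▸ hcov.coverDist_ne_top s t)⟩
    refine ⟨v, hv, ?_, τ, ?_, x, hx⟩
    · have hi : Cover.subgraphDist (T i) s t = Cover.coverDist C s t :=
        le_antisymm (hi₀ ▸ hmin i₀) (Cover.coverDist_le (hTC i) s t)
      have : (d v t : ℕ∞) < d s t := by
        rw [hd', hd', ← hi]
        exact (Cover.coverDist_le (hTC i) v t).trans_lt hvd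
      exact_mod_cast this
    · have := hk s
      have := hk t
      have := hk1 s
      omega
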